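/- Let $D\subset\mathbb{R}^d$ be a bounded open set (the interior of a coarse element $D^m_H$), let $K\ge 1$, $\Gamma=[-1,1]^{K}$, and let $\kappa:D\times\Gamma\to\mathbb{R}$ be a coefficient such that $\kappa(\cdot,\xi)$ is measurable for every $\xi\in\Gamma$; for some constants $0<\kappa_{\min}\le\kappa_{\max}<\infty$ and every $\xi\in\Gamma$ one has $\kappa_{\min}\le\kappa(x,\xi)\le\kappa_{\max}$ for a.e. $x\in D$; and, for a.e. $x\in D$, $\kappa(x,\cdot)$ is infinitely differentiable on $\Gamma$. Fix $k\in\{1,\dots,K\}$ and assume that there is $c_k>0$ with $$\left\|\frac{\partial^{n}_{\xi_k}\kappa(\cdot,\xi)}{\kappa(\cdot,\xi)}\right\|_{L^\infty(D)}\le c_k^{\,n}\,n!\qquad\text{for all } n\ge 0,\ \xi\in\Gamma .$$ Let $p^1,\dots,p^L\in H^1(D)$ represent deterministic boundary data, and for each $l\in\{1,\dots,L\}$ and $\xi\in\Gamma$ let $\phi^l(\cdot,\xi)\in H^1(D)$ be the weak solution of the cell problem $$-\nabla\cdot(\kappa(x,\xi)\nabla\phi^l(x,\xi))=0\ \text{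 in } D,\qquad \phi^l(\cdot,\xi)=p^l\ \text{ on }\partial D,$$ that is, $\phi^l(\cdot,\xi)-p^l\in H^1_0(D)$ and $\int_D\kappa(x,\xi)\nabla\phi^l(x,\xi)\cdot\nabla v(x)\,dx=0$ for all $v\in H^1_0(D)$. Define the local upscaled stiffness matrix by $$S_{ll'}(\xi)=\int_D\kappa(x,\xi)\,\nabla\phi^l(x,\xi)\cdot\nabla\phi^{l'}(x,\xi)\,dx .$$ Then for all $l,l'\in\{1,\dots,L\}$ and every $\tau_k$ with $0<\tau_k<\frac{1}{2c_k}$, the entry $S_{ll'}$, viewed as a function of $\xi_k\in[-1,1]$ with values in $C([-1,1]^{K-1})$ (continuous functions of the remaining parameters, with the supremum norm), admits an analytic extension to the complex region $$\Sigma([-1,1];\tau_k)=\{z\in\mathbb{C}:\ \operatorname{dist}(z,[-1,1])\le\tau_k\},$$ that is, there is a map $F:\mathbb{C}\to C([-1,1]^{K-1};\mathbb{C})$ that is analytic at every point of $\Sigma([-1,1];\tau_k)$ and satisfies $F(t)=S_{ll'}|_{\xi_k=t}$ for all $t\in[-1,1]$. -/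

import Mathlib

open MeasureTheory Set Filter Topology
open scoped ContDiff Gradient RealInnerProductSpace

namespace StoMsFEM

/-- Physical space, with the Euclidean norm. -/
abbrev Space (d : ℕ) : Type := EuclideanSpace ℝ (Fin d)

/-- The test functions on an open set `D`: the class `C_c^∞(D)`. -/
def IsTestFunction {d : ℕ} (D : Set (Space d)) (ψ : Space d → ℝ) : Prop :=
  ContDiff ℝ ∞ ψ ∧ HasCompactSupport ψ ∧ tsupport ψ ⊆ D

/-- `G` is a weak (distributional) gradient of `u` on the open set `D`. -/
def HasWeakGradient {d : ℕ} (D : Set (Space d)) (u : Space d → ℝ) (G : Space d → Space d) :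
    Prop :=
  LocallyIntegrableOn u D ∧ LocallyIntegrableOn G D ∧
    ∀ ψ : Space d → ℝ, IsTestFunction D ψ →
      ∫ x in D, u x • gradient ψ x = -∫ x in D, ψ x • G x

open Classical in
/-- The weak gradient of `u` on `D` (unique up to a null set of `D` when it exists;
zero by convention when there is none). -/
noncomputable def weakGradient {d : ℕ} (D : Set (Space d)) (u : Space d → ℝ) :
    Space d → Space d :=
  if h : ∃ G, HasWeakGradient D u G then h.choose else 0

/-- Membership in the Sobolev space `H¹(D)`. -/
def MemH1 {d : ℕ} (D : Set (Space d)) (u : Space d → ℝ) : Prop :=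
  MemLp u 2 (volume.restrict D) ∧
    ∃ G, HasWeakGradient D u G ∧ MemLp G 2 (volume.restrict D)

/-- Membership in `H¹₀(D)`: the closure of the test functions in `H¹(D)`. -/
def MemH10 {d : ℕ} (D : Set (Space d)) (u : Space d → ℝ) : Prop :=
  MemH1 D u ∧ ∃ ψ : ℕ → Space d → ℝ, (∀ j, IsTestFunction D (ψ j)) ∧
    Tendsto (fun j => eLpNorm (fun x => u x - ψ j x) 2 (volume.restrict D)) atTop (𝓝 0) ∧
    Tendsto (fun j => eLpNorm (fun x => weakGradient D u x - gradient (ψ j) x) 2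
      (volume.restrict D)) atTop (𝓝 0)

/-- The energy form `∫_D a ∇u · ∇v`. -/
noncomputable def energyForm {d : ℕ} (D : Set (Space d)) (a : Space d → ℝ)
    (u v : Space d → ℝ) : ℝ :=
  ∫ x in D, a x * ⟪weakGradient D u x, weakGradient D v x⟫

/-- `u` is the weak solution of the cell problem `-∇·(a ∇u) = 0` in `D`, `u = p` on `∂D`,
where the boundary datum is represented by a function `p` in `H¹(D)`. -/
def IsCellSolution {d : ℕ} (D : Set (Space d)) (a p u : Space d → ℝ) : Prop :=
  MemH1 D u ∧ MemH10 D (fun x => u x - p x) ∧ ∀ v, MemH10 D v → energyForm D a u v = 0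

/-- The parameter cube `[-1,1]^K`. -/
def paramCube (K : ℕ) : Set (Fin K → ℝ) := {ξ | ∀ j, ξ j ∈ Icc (-1 : ℝ) 1}

/-- The `n`-th partial derivative of `f` in the `k`-th parameter at a point `ξ` of the cube
(one-sided on the faces `ξ k = ±1`). -/
noncomputable def paramDeriv {K : ℕ} (k : Fin K) (n : ℕ) (f : (Fin K → ℝ) → ℝ)
    (ξ : Fin K → ℝ) : ℝ :=
  iteratedDerivWithin n (fun t => f (Function.update ξ k t)) (Icc (-1 : ℝ) 1) (ξ k)

/-- The parameter vector with `k`-th coordinate `t` and remaining coordinates `η`. -/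
def joinParam {n : ℕ} (k : Fin (n + 1)) (t : ℝ) (η : Fin n → Icc (-1 : ℝ) 1) :
    Fin (n + 1) → ℝ :=
  k.insertNth (α := fun _ => ℝ) t (fun j => (η j : ℝ))

/-- The local upscaled stiffness matrix
`S_{ll'}(ξ) = ∫_D κ(x,ξ) ∇φ_l(x,ξ) · ∇φ_{l'}(x,ξ) dx`. -/
noncomputable def stiffness {d K L : ℕ} (D : Set (Space d))
    (κ : Space d → (Fin K → ℝ) → ℝ) (φ : Fin L → (Fin K → ℝ) → Space d → ℝ)
    (ξ : Fin K → ℝ) : Matrix (Fin L) (Fin L) ℝ :=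
  Matrix.of fun l l' => energyForm D (fun x => κ x ξ) (φ l ξ) (φ l' ξ)

/-- The complex neighbourhood `{z : dist(z, [-1,1]) ≤ τ}`. -/
def sigmaRegion (τ : ℝ) : Set ℂ :=
  {z | Metric.infDist z ((fun t : ℝ => (t : ℂ)) '' Icc (-1 : ℝ) 1) ≤ τ}

end StoMsFEM

/-! Everything is done with gradients in `L²(D)`. Fix the other parameters η and a centre t₀, put h
= t - t₀, and factor the coefficient as κ(t) = w S w with w = √κ(t₀) and S = κ(t)/κ(t₀). The growth
hypothesis says exactly that S = ∑ hⁱ Tᵢ with T₀ = 1 and ‖Tᵢ‖ ≤ cⁱ as multiplication operators. For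
U = w∇φ the cell problem reads S U ⊥ K, where K is w times the closed space of test gradients.
Orthogonal projection onto K has norm one in this weighting, so the recursion for the coefficients
of U involves neither κmin nor κmax, and summing geometric terms gives ‖Uₘ‖ ≤ (2c)ᵐ‖U₀‖. This is
where the radius 1/(2c) comes from. Galerkin orthogonality turns the stiffness entry into ⟪S U,
w∇p'⟫, so only one of the two solutions has to be expanded (`hasSum_inner_of_galerkin`,
`exists_hasSum_energy`, `exists_hasSum_energy_of_growth`).

The resulting bounds on the coefficients depend only on c, κmax and the boundary data, hence are
uniform in t₀ and η. The entry itself is continuous in η (`continuous_stiffness_joinParam`), and by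
uniformity so is each coefficient (`continuous_coeff_of_hasSum`). The expansions are thus power
series in the Banach space of continuous functions of η. Their sums on discs centred in [-1,1] agree
on overlaps by the identity theorem and glue together (`exists_analytic_extension_sigmaRegion`). -/

namespace StoMsFEM

/-! ### Perturbation series for a Galerkin problem in a Hilbert space -/

section Perturbation

variable {H : Type*} [NormedAddCommGroup H] [InnerProductSpace ℝ H]

/-- Coefficients of the formal power series `∑ hᵐ Uₘ` with `Uₘ ∈ K` for `m ≥ 1` such that all
coefficients of `(∑ hⁱ Tᵢ) (∑ hʲ Uⱼ)` are orthogonal to `K`. -/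
noncomputable def galerkinCoeff (K : Submodule ℝ H) [K.HasOrthogonalProjection]
    (T : ℕ → H →L[ℝ] H) (U₀ : H) : ℕ → H
  | 0 => U₀
  | m + 1 => -K.starProjection (∑ i : Fin (m + 1), T (m + 1 - i) (galerkinCoeff K T U₀ i))

variable (K : Submodule ℝ H) [K.HasOrthogonalProjection] {T : ℕ → H →L[ℝ] H} {U₀ : H} {c h : ℝ}

theorem galerkinCoeff_succ (T : ℕ → H →L[ℝ] H) (U₀ : H) (m : ℕ) :
    galerkinCoeff K T U₀ (m + 1) =
      -K.starProjection (∑ i ∈ Finset.range (m + 1), T (m + 1 - i) (galerkinCoeff K T U₀ i)) := by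
  rw [galerkinCoeff, Finset.sum_range (fun i => T (m + 1 - i) (galerkinCoeff K T U₀ i))]

/-- The projection does not increase norms, and inserting the inductive bound gives c^(m+1)‖U₀‖
times 1 + 2 + ⋯ + 2^m < 2^(m+1). Hence the ratio 2c. -/
theorem norm_galerkinCoeff_le (hc : 0 ≤ c) (hT : ∀ i, ‖T i‖ ≤ c ^ i) (m : ℕ) :
    ‖galerkinCoeff K T U₀ m‖ ≤ (2 * c) ^ m * ‖U₀‖ := by
  induction m using Nat.strong_induction_on with
  | _ m ih =>
    cases m with
    | zero => simp [galerkinCoeff]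
    | succ m =>
      rw [galerkinCoeff_succ, norm_neg]
      calc _ ≤ ‖∑ i ∈ Finset.range (m + 1), T (m + 1 - i) (galerkinCoeff K T U₀ i)‖ :=
            K.norm_starProjection_apply_le _
        _ ≤ ∑ i ∈ Finset.range (m + 1), c ^ (m + 1) * ‖U₀‖ * 2 ^ i := by
            refine norm_sum_le_of_le _ fun i hi => ?_
            have hi' : i < m + 1 := Finset.mem_range.1 hi
            calc _ ≤ c ^ (m + 1 - i) * ((2 * c) ^ i * ‖U₀‖) :=
                  (T _).le_of_opNorm_le_of_le (hT _) (ih i hi')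
              _ = (c ^ (m + 1 - i) * c ^ i) * ‖U₀‖ * 2 ^ i := by rw [mul_pow]; ring
              _ = _ := by rw [← pow_add, Nat.sub_add_cancel hi'.le]
        _ = c ^ (m + 1) * ‖U₀‖ * (2 ^ (m + 1) - 1) := by
            rw [← Finset.mul_sum, geom_sum_eq (by norm_num)]; norm_num
        _ ≤ c ^ (m + 1) * ‖U₀‖ * 2 ^ (m + 1) := by gcongr; linarith
        _ = _ := by rw [mul_pow]; ring

/-- Since T₀ = 1, the newest coefficient enters undistorted and subtracts exactly the K-component of
the remaining terms. -/
theorem sum_antidiagonal_galerkinCoeff_mem_orthogonal (hT0 : T 0 = 1) (hU₀ : U₀ ∈ Kᗮ) (m : ℕ) :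
    ∑ ij ∈ Finset.HasAntidiagonal.antidiagonal m, T ij.1 (galerkinCoeff K T U₀ ij.2) ∈ Kᗮ := by
  cases m with
  | zero => simpa [galerkinCoeff, hT0] using hU₀
  | succ m =>
    rw [← Finset.Nat.sum_antidiagonal_swap, Finset.Nat.sum_antidiagonal_eq_sum_range_succ_mk,
      Finset.sum_range_succ]
    simp only [Prod.swap, Nat.sub_self, hT0, one_apply_eq_self]
    rw [galerkinCoeff_succ, ← sub_eq_add_neg]
    exact K.sub_starProjection_mem_orthogonal _

theorem norm_sum_antidiagonal_galerkinCoeff_le (hc : 0 ≤ c) (hT : ∀ i, ‖T i‖ ≤ c ^ i) (m : ℕ) :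
    ‖∑ ij ∈ Finset.HasAntidiagonal.antidiagonal m, T ij.1 (galerkinCoeff K T U₀ ij.2)‖ ≤
      2 * (2 * c) ^ m * ‖U₀‖ := by
  rw [← Finset.Nat.sum_antidiagonal_swap, Finset.Nat.sum_antidiagonal_eq_sum_range_succ_mk]
  calc _ ≤ ∑ i ∈ Finset.range (m + 1), c ^ m * ‖U₀‖ * 2 ^ i := by
        refine norm_sum_le_of_le _ fun i hi => ?_
        have hi' : i ≤ m := Nat.lt_succ_iff.1 (Finset.mem_range.1 hi)
        calc _ ≤ c ^ (m - i) * ((2 * c) ^ i * ‖U₀‖) :=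
              (T _).le_of_opNorm_le_of_le (hT _) (norm_galerkinCoeff_le K hc hT i)
          _ = (c ^ (m - i) * c ^ i) * ‖U₀‖ * 2 ^ i := by rw [mul_pow]; ring
          _ = _ := by rw [← pow_add, Nat.sub_add_cancel hi']
    _ = c ^ m * ‖U₀‖ * (2 ^ (m + 1) - 1) := by
        rw [← Finset.mul_sum, geom_sum_eq (by norm_num)]; norm_num
    _ ≤ c ^ m * ‖U₀‖ * 2 ^ (m + 1) := by gcongr; linarith
    _ = _ := by rw [mul_pow]; ring

variable [CompleteSpace H]

/-- Cauchy product of a power series of operators with a power series of vectors. -/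
theorem hasSum_antidiagonal_apply {T : ℕ → H →L[ℝ] H} {u : ℕ → H} {c r C h : ℝ} {S : H →L[ℝ] H}
    (hc : 0 ≤ c) (hr : 0 ≤ r) (hT : ∀ i, ‖T i‖ ≤ c ^ i) (hu : ∀ j, ‖u j‖ ≤ r ^ j * C)
    (hch : c * |h| < 1) (hrh : r * |h| < 1) (hS : HasSum (fun i => h ^ i • T i) S) :
    HasSum (fun m => h ^ m • ∑ ij ∈ Finset.HasAntidiagonal.antidiagonal m, T ij.1 (u ij.2))
      (S (∑' j, h ^ j • u j)) := by
  have hu' : ∀ j, ‖h ^ j • u j‖ ≤ (r * |h|) ^ j * C := fun j => by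
    rw [norm_smul, norm_pow, Real.norm_eq_abs, mul_pow]
    calc _ ≤ |h| ^ j * (r ^ j * C) := by gcongr; exact hu j
      _ = _ := by ring
  have hT' : ∀ i, ‖h ^ i • T i‖ ≤ (c * |h|) ^ i := fun i => by
    rw [norm_smul, norm_pow, Real.norm_eq_abs, mul_pow]
    calc _ ≤ |h| ^ i * c ^ i := by gcongr; exact hT i
      _ = _ := by ring
  have su : Summable fun j => h ^ j • u j :=
    Summable.of_norm_bounded ((summable_geometric_of_lt_one (by positivity) hrh).mul_right C) hu'
  -- This double family is absolutely summable, so it may be summed by rows (giving the value) or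
  -- along antidiagonals (giving the series).
  let f : ℕ × ℕ → H := fun ij => (h ^ ij.1 • T ij.1) (h ^ ij.2 • u ij.2)
  have hf : Summable f := by
    have hC : 0 ≤ C := by simpa using (norm_nonneg _).trans (hu 0)
    have := Summable.mul_of_nonneg (summable_geometric_of_lt_one (r := c * |h|) (by positivity) hch)
      ((summable_geometric_of_lt_one (r := r * |h|) (by positivity) hrh).mul_right C)
      (fun i => by positivity) (fun i => by positivity)
    exact Summable.of_norm_bounded this fun ij =>
      ContinuousLinearMap.le_of_opNorm_le_of_le _ (hT' _) (hu' _)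
  have hval : ∑' ij, f ij = S (∑' j, h ^ j • u j) := by
    have h1 : ∀ i, HasSum (fun j => f (i, j)) ((h ^ i • T i) (∑' j, h ^ j • u j)) := fun i =>
      su.hasSum.mapL (h ^ i • T i)
    have h2 := hf.hasSum.prod_fiberwise h1
    exact h2.unique (hS.mapL (ContinuousLinearMap.apply ℝ H (∑' j, h ^ j • u j)))
  have h3 := (Finset.HasAntidiagonal.sigmaAntidiagonalEquivProd (A := ℕ)).hasSum_iff.2 (hval ▸ hf.hasSum)
  have h4 := h3.sigma fun m => hasSum_fintype _
  convert h4 using 2 with m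
  rw [Finset.univ_eq_attach, Finset.smul_sum, ← Finset.sum_attach]
  refine Finset.sum_congr rfl fun ij _ => ?_
  obtain ⟨⟨i, j⟩, hij⟩ := ij
  rw [Finset.HasAntidiagonal.mem_antidiagonal] at hij
  simp [f, ← hij, pow_add, smul_smul, mul_comm]

/-- The formal series converges to a solution V of the same problem as U: both lie in U₀ + K and are
mapped by S into Kᗮ. As S is close to the identity, the solution is unique, so U = V and the Cauchy
product for S V can be paired with P. -/
theorem hasSum_inner_of_galerkin (hc : 0 ≤ c) (hT0 : T 0 = 1) (hT : ∀ i, ‖T i‖ ≤ c ^ i)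
    (hU₀ : U₀ ∈ Kᗮ) (hK : IsClosed (K : Set H)) (hch : 2 * c * |h| < 1) {S : H →L[ℝ] H}
    (hS : HasSum (fun i => h ^ i • T i) S) {U : H} (hU : U - U₀ ∈ K) (hSU : S U ∈ Kᗮ) (P : H) :
    HasSum (fun m => ⟪∑ ij ∈ Finset.HasAntidiagonal.antidiagonal m, T ij.1 (galerkinCoeff K T U₀ ij.2), P⟫ * h ^ m)
      ⟪S U, P⟫ := by
  set u := galerkinCoeff K T U₀ with hu
  have hch' : c * |h| < 1 / 2 := by linarith
  have hub := norm_galerkinCoeff_le K (U₀ := U₀) hc hT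
  have key := hasSum_antidiagonal_apply hc (by positivity) hT hub (by linarith) hch hS
  set V := ∑' j, h ^ j • u j with hV
  have su : Summable fun j => h ^ j • u j := by
    refine Summable.of_norm_bounded ((summable_geometric_of_lt_one (by positivity) hch).mul_right
      ‖U₀‖) fun j => ?_
    rw [norm_smul, norm_pow, Real.norm_eq_abs, mul_pow _ |h|]
    calc _ ≤ |h| ^ j * ((2 * c) ^ j * ‖U₀‖) := by gcongr; exact hub j
      _ = _ := by ring
  have hVK : V - U₀ ∈ K := by
    have h1 : V = U₀ + ∑' j, h ^ (j + 1) • u (j + 1) := by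
      rw [hV, su.tsum_eq_zero_add]; simp [hu, galerkinCoeff]
    rw [h1, add_sub_cancel_left]
    refine hK.mem_of_tendsto ((summable_nat_add_iff 1).2 su).hasSum
      (Eventually.of_forall fun s => K.sum_mem fun j _ => K.smul_mem _ ?_)
    rw [hu, galerkinCoeff_succ]
    exact K.neg_mem (K.starProjection_apply_mem _)
  have hSV : S V ∈ Kᗮ :=
    (Submodule.isClosed_orthogonal K).mem_of_tendsto key (Eventually.of_forall fun s =>
      Kᗮ.sum_mem fun m _ => Kᗮ.smul_mem _ (sum_antidiagonal_galerkinCoeff_mem_orthogonal K hT0 hU₀ m))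
  have hUV : U = V := by
    have hD : U - V ∈ K := by simpa using K.sub_mem hU hVK
    have hSD : ⟪S (U - V), U - V⟫ = 0 := by
      rw [map_sub, real_inner_comm]; exact (Kᗮ.sub_mem hSU hSV) _ hD
    -- The tail of the series after T₀ = 1 is at most c|h| / (1 - c|h|), which is below 1 precisely
    -- because c|h| < 1/2. This makes S coercive.
    have hS1 : ‖1 - S‖ < 1 := by
      have := norm_sub_le_of_geometric_bound_of_hasSum (r := c * |h|) (C := 1) (by linarith)
        (fun i => by
          rw [norm_smul, norm_pow, Real.norm_eq_abs, mul_pow, one_mul, mul_comm]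
          gcongr; exact hT i) hS 1
      simp only [Finset.sum_range_one, pow_zero, one_smul, hT0, pow_one, one_mul] at this
      refine this.trans_lt ?_
      rw [div_lt_one (by linarith)]; linarith
    have h2 : ‖U - V‖ ^ 2 ≤ ‖1 - S‖ * ‖U - V‖ ^ 2 := by
      calc _ = ⟪(1 - S) (U - V), U - V⟫ := by
            rw [sub_apply, inner_sub_left, hSD, sub_zero,
              one_apply_eq_self, real_inner_self_eq_norm_sq]
        _ ≤ ‖(1 - S) (U - V)‖ * ‖U - V‖ := real_inner_le_norm _ _
        _ ≤ ‖1 - S‖ * ‖U - V‖ * ‖U - V‖ := by gcongr; exact (1 - S).le_opNorm _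
        _ = _ := by ring
    have h3 : ‖U - V‖ ^ 2 = 0 := by nlinarith [sq_nonneg ‖U - V‖]
    exact sub_eq_zero.1 (by simpa using h3)
  rw [hUV]
  have e : (fun m => ⟪∑ ij ∈ Finset.HasAntidiagonal.antidiagonal m, T ij.1 (u ij.2), P⟫ * h ^ m) =
      fun m => innerSL ℝ P
        (h ^ m • ∑ ij ∈ Finset.HasAntidiagonal.antidiagonal m, T ij.1 (u ij.2)) := by
    ext m
    rw [innerSL_apply_apply, inner_smul_right, real_inner_comm, mul_comm]
  rw [e, real_inner_comm P (S V)]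
  exact key.mapL (innerSL ℝ P)

end Perturbation

/-! ### Parameter-uniform power series and gluing of their complex extensions -/

section Extension

theorem mem_closure_Icc_diff_singleton {t₀ : ℝ} (ht₀ : t₀ ∈ Icc (-1 : ℝ) 1) :
    t₀ ∈ closure (Icc (-1 : ℝ) 1 \ {t₀}) := by
  rw [mem_closure_iff_nhdsWithin_neBot]
  rcases lt_or_ge t₀ 1 with h | h
  · have : (𝓝[Ioo t₀ 1] t₀).NeBot := by rw [nhdsWithin_Ioo_eq_nhdsGT h]; infer_instance
    exact this.mono (nhdsWithin_mono _ fun t ht =>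
      ⟨⟨ht₀.1.trans ht.1.le, ht.2.le⟩, ht.1.ne'⟩)
  · have h' : (-1 : ℝ) < t₀ := by linarith
    have : (𝓝[Ioo (-1) t₀] t₀).NeBot := by rw [nhdsWithin_Ioo_eq_nhdsLT h']; infer_instance
    exact this.mono (nhdsWithin_mono _ fun t ht =>
      ⟨⟨ht.1.le, ht.2.le.trans ht₀.2⟩, ht.2.ne⟩)

/-- The coefficients of power series that are bounded uniformly in a parameter depend continuously
on the parameter if the sums do. -/
theorem continuous_coeff_of_hasSum {Q : Type*} [TopologicalSpace Q] {A : Set ℝ} {t₀ ρ C : ℝ}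
    {f : ℝ → Q → ℝ} {s : ℕ → Q → ℝ} (hA : (𝓝[A \ {t₀}] t₀).NeBot)
    (hρ : 0 < ρ) (hf : ∀ t ∈ A, Continuous (f t))
    (hs : ∀ m q, |s m q| ≤ C * ρ ^ m)
    (hsum : ∀ t ∈ A, ρ * |t - t₀| < 1 → ∀ q, HasSum (fun m => s m q * (t - t₀) ^ m) (f t q))
    (m : ℕ) : Continuous (s m) := by
  induction m using Nat.strong_induction_on with
  | _ m ih =>
    -- Quotient of the remainder of order m by (t - t₀)^m. It is continuous in q by induction and
    -- converges to the m-th coefficient uniformly in q as t → t₀.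
    let r : ℝ → Q → ℝ := fun t q =>
      (f t q - ∑ j ∈ Finset.range m, s j q * (t - t₀) ^ j) / (t - t₀) ^ m
    have hr : ∀ t ∈ A, Continuous (r t) := fun t ht =>
      ((hf t ht).sub (continuous_finsetSum _ fun j hj =>
        (ih j (Finset.mem_range.1 hj)).mul continuous_const)).div_const _
    have hnear : ∀ᶠ t in 𝓝[A \ {t₀}] t₀, ρ * |t - t₀| < 1 / 2 := by
      have : Tendsto (fun t => ρ * |t - t₀|) (𝓝[A \ {t₀}] t₀) (𝓝 (ρ * |t₀ - t₀|)) :=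
        (Continuous.tendsto (by fun_prop) t₀).mono_left nhdsWithin_le_nhds
      exact this.eventually_lt_const (by simp)
    have hbound : ∀ᶠ t in 𝓝[A \ {t₀}] t₀, ∀ q, |s m q - r t q| ≤
        C * ρ ^ (m + 1) * 2 * |t - t₀| := by
      filter_upwards [hnear, self_mem_nhdsWithin] with t ht htA q
      have hne : t - t₀ ≠ 0 := sub_ne_zero.2 htA.2
      have hC : 0 ≤ C := by simpa using (abs_nonneg _).trans (hs 0 q)
      have h1 := norm_sub_le_of_geometric_bound_of_hasSum (r := ρ * |t - t₀|) (C := C)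
        (by linarith) (fun i => by
          rw [Real.norm_eq_abs, abs_mul, abs_pow, mul_pow, ← mul_assoc]
          gcongr; exact hs i q) (hsum t htA.1 (by linarith) q) (m + 1)
      have h2 : s m q - r t q = ((∑ j ∈ Finset.range (m + 1), s j q * (t - t₀) ^ j) - f t q) /
          (t - t₀) ^ m := by
        simp only [r]
        rw [Finset.sum_range_succ]
        field_simp
        ring
      rw [h2, abs_div, abs_pow, div_le_iff₀ (by positivity)]
      refine (Real.norm_eq_abs _ ▸ h1).trans ?_
      rw [div_le_iff₀ (by linarith)]
      have : 0 ≤ C * (ρ * |t - t₀|) ^ (m + 1) := by positivity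
      calc _ ≤ C * (ρ * |t - t₀|) ^ (m + 1) * (2 * (1 - ρ * |t - t₀|)) :=
            le_mul_of_one_le_right this (by linarith)
        _ = _ := by rw [mul_pow]; ring
    have hunif : TendstoUniformly r (s m) (𝓝[A \ {t₀}] t₀) := by
      rw [Metric.tendstoUniformly_iff]
      intro ε hε
      have : Tendsto (fun t => C * ρ ^ (m + 1) * 2 * |t - t₀|) (𝓝[A \ {t₀}] t₀)
          (𝓝 (C * ρ ^ (m + 1) * 2 * |t₀ - t₀|)) :=
        (Continuous.tendsto (by fun_prop) t₀).mono_left nhdsWithin_le_nhds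
      filter_upwards [hbound, this.eventually_lt_const (u := ε) (by simpa using hε)] with t h1 h2 q
      exact (h1 q).trans_lt h2
    refine hunif.continuous (Eventually.frequently ?_)
    filter_upwards [self_mem_nhdsWithin] with t ht using hr t ht.1

/-- A power series with coefficients in a complex Banach space satisfying a geometric bound is
analytic in its disc of convergence. -/
theorem analyticOnNhd_tsum_smul {E : Type*} [NormedAddCommGroup E] [NormedSpace ℂ E]
    [CompleteSpace E] {s : ℕ → E} {C ρ R : ℝ} (hρ : 0 ≤ ρ) (hR : ρ * R < 1) (hR0 : 0 < R)
    (hs : ∀ m, ‖s m‖ ≤ C * ρ ^ m) (z₀ : ℂ) :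
    AnalyticOnNhd ℂ (fun z => ∑' m, (z - z₀) ^ m • s m) (Metric.ball z₀ R) := by
  refine DifferentiableOn.analyticOnNhd ?_ Metric.isOpen_ball
  refine Complex.differentiableOn_tsum_of_summable_norm
    ((summable_geometric_of_lt_one (by positivity) hR).mul_left C)
    (fun m => Differentiable.differentiableOn (by fun_prop)) Metric.isOpen_ball fun m w hw => ?_
  have hw' : ‖w - z₀‖ ≤ R := by rw [← dist_eq_norm]; exact (Metric.mem_ball.1 hw).le
  rw [norm_smul, norm_pow, mul_pow]
  calc _ ≤ R ^ m * (C * ρ ^ m) := by gcongr; exact hs m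
    _ = _ := by ring

/-- Local complex extensions of a function on `[-1, 1]`, given on the discs of radius `R`, can be
glued to an extension to any smaller closed neighbourhood. -/
theorem exists_analytic_extension_sigmaRegion {E : Type*} [NormedAddCommGroup E] [NormedSpace ℂ E]
    [CompleteSpace E] {g : ℝ → E} {R τ : ℝ} (hR : 0 < R) (hτR : τ < R)
    {G : ℝ → ℂ → E} (hG : ∀ t ∈ Icc (-1 : ℝ) 1, AnalyticOnNhd ℂ (G t) (Metric.ball (t : ℂ) R))
    (hGg : ∀ t ∈ Icc (-1 : ℝ) 1, ∀ s ∈ Icc (-1 : ℝ) 1, |s - t| < R → G t s = g s) :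
    ∃ F : ℂ → E, AnalyticOnNhd ℂ F (sigmaRegion τ) ∧ ∀ t ∈ Icc (-1 : ℝ) 1, F t = g t := by
  set I : Set ℂ := (fun t : ℝ => (t : ℂ)) '' Icc (-1 : ℝ) 1 with hI
  have hIc : IsCompact I := isCompact_Icc.image Complex.continuous_ofReal
  have hIn : I.Nonempty := ⟨_, 0, by simp, rfl⟩
  have hproj : ∀ z : ℂ, ∃ t ∈ Icc (-1 : ℝ) 1, Metric.infDist z I = dist z t := fun z => by
    obtain ⟨_, ⟨t, ht, rfl⟩, h⟩ := hIc.exists_infDist_eq_dist hIn z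
    exact ⟨t, ht, h⟩
  -- A nearest point of [-1,1]; no continuity of this choice is needed, since the local extensions
  -- agree wherever two discs overlap.
  choose π hπ hπd using hproj
  have hagree : ∀ t ∈ Icc (-1 : ℝ) 1, ∀ s ∈ Icc (-1 : ℝ) 1, ∀ z : ℂ, dist z t < R →
      dist z s < R → G t z = G s z := by
    intro t ht s hs z hzt hzs
    rcases eq_or_ne t s with rfl | hts
    · rfl
    have hts' : |t - s| < 2 * R := by
      have h1 : dist (t : ℂ) (s : ℂ) < 2 * R := by
        linarith [dist_triangle_left (t : ℂ) (s : ℂ) z]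
      rwa [Complex.dist_eq, ← Complex.ofReal_sub, Complex.norm_real, Real.norm_eq_abs] at h1
    set U := Metric.ball (t : ℂ) R ∩ Metric.ball (s : ℂ) R with hU
    have hUc : IsPreconnected U :=
      ((convex_ball (t : ℂ) R).inter (convex_ball (s : ℂ) R)).isPreconnected
    -- The overlap is convex and contains the real midpoint. For t ≠ s this point is interior to
    -- [-1,1], so both extensions equal `g` at all nearby real points, and the identity theorem
    -- applies.
    have hmid : ((((t + s) / 2 : ℝ) : ℂ)) ∈ U := by
      have e1 : (t + s) / 2 - t = -((t - s) / 2) := by ring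
      have e2 : (t + s) / 2 - s = (t - s) / 2 := by ring
      constructor <;>
      · rw [Metric.mem_ball, Complex.dist_eq, ← Complex.ofReal_sub, Complex.norm_real,
          Real.norm_eq_abs]
        first | rw [e1, abs_neg, abs_div] | rw [e2, abs_div]
        norm_num; linarith
    have hmidI : (t + s) / 2 ∈ Ioo (-1 : ℝ) 1 := by
      rcases lt_or_gt_of_ne hts with h | h <;>
        exact ⟨by linarith [ht.1, hs.1], by linarith [ht.2, hs.2]⟩
    refine AnalyticOnNhd.eqOn_of_preconnected_of_frequently_eq
      ((hG t ht).mono inter_subset_left) ((hG s hs).mono inter_subset_right) hUc hmid ?_ ⟨hzt, hzs⟩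
    have hev : ∀ᶠ r : ℝ in 𝓝[≠] ((t + s) / 2), G t r = G s r := by
      have hUo : IsOpen U := Metric.isOpen_ball.inter Metric.isOpen_ball
      have h1 : ∀ᶠ r : ℝ in 𝓝 ((t + s) / 2), (r : ℂ) ∈ U :=
        Complex.continuous_ofReal.continuousAt.eventually (hUo.mem_nhds hmid)
      filter_upwards [nhdsWithin_le_nhds h1, nhdsWithin_le_nhds (Ioo_mem_nhds hmidI.1 hmidI.2)]
        with r hr hrI
      have hr1 := hr.1
      have hr2 := hr.2
      rw [Metric.mem_ball, Complex.dist_eq, ← Complex.ofReal_sub, Complex.norm_real,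
          Real.norm_eq_abs] at hr1 hr2
      rw [hGg t ht r ⟨hrI.1.le, hrI.2.le⟩ hr1, hGg s hs r ⟨hrI.1.le, hrI.2.le⟩ hr2]
    have htend : Tendsto (fun r : ℝ => (r : ℂ)) (𝓝[≠] ((t + s) / 2))
        (𝓝[≠] (((t + s) / 2 : ℝ) : ℂ)) :=
      tendsto_nhdsWithin_of_tendsto_nhds_of_eventually_within _
        (Complex.continuous_ofReal.continuousAt.tendsto.mono_left nhdsWithin_le_nhds)
        (eventually_mem_nhdsWithin.mono fun r hr => by
          rw [mem_compl_singleton_iff] at hr ⊢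
          exact_mod_cast hr)
    exact htend.frequently hev.frequently
  refine ⟨fun z => G (π z) z, fun z hz => ?_, fun t ht => ?_⟩
  · have hzd : dist z (π z) < R := by
      rw [← hπd]; exact lt_of_le_of_lt hz hτR
    refine (hG _ (hπ z) z hzd).congr ?_
    have h1 : ∀ᶠ w : ℂ in 𝓝 z, dist w (π z) < R := Metric.isOpen_ball.mem_nhds hzd
    have h2 : ∀ᶠ w : ℂ in 𝓝 z, Metric.infDist w I < R :=
      (Metric.continuous_infDist_pt I).continuousAt.eventually_lt_const (lt_of_le_of_lt hz hτR)
    filter_upwards [h1, h2] with w hw1 hw2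
    exact hagree _ (hπ z) _ (hπ w) w hw1 (by rwa [← hπd])
  · have h0 : dist (t : ℂ) (π t) = 0 := by
      rw [← hπd]; exact Metric.infDist_zero_of_mem ⟨t, ht, rfl⟩
    have h1 : π t = t := by
      have := dist_eq_zero.1 h0
      exact_mod_cast this.symm
    simpa only [h1] using hGg t ht t ht (by simpa using hR)

/-- A family of functions on `[-1, 1]`, continuous in a parameter and with power series
expansions at all points that are bounded uniformly in the parameter, extends analytically to a
complex neighbourhood, with values in the continuous functions of the parameter. -/
theorem exists_analytic_extension_of_powerSeries {Q : Type*} [TopologicalSpace Q] [CompactSpace Q]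
    {f : ℝ → Q → ℝ} {ρ τ C : ℝ} (hρ : 0 < ρ) (hτ : 0 < τ) (hτρ : τ < 1 / ρ)
    (hf : ∀ t ∈ Icc (-1 : ℝ) 1, Continuous (f t))
    (hser : ∀ t₀ ∈ Icc (-1 : ℝ) 1, ∀ q, ∃ s : ℕ → ℝ, (∀ m, |s m| ≤ C * ρ ^ m) ∧
      ∀ t ∈ Icc (-1 : ℝ) 1, ρ * |t - t₀| < 1 → HasSum (fun m => s m * (t - t₀) ^ m) (f t q)) :
    ∃ F : ℂ → C(Q, ℂ), AnalyticOnNhd ℂ F (sigmaRegion τ) ∧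
      ∀ t ∈ Icc (-1 : ℝ) 1, ∀ q, F t q = (f t q : ℂ) := by
  classical
  -- R > τ lets the open discs cover the closed region, and R < 1/ρ keeps the series geometrically
  -- convergent on each disc.
  obtain ⟨R, hτR, hRρ⟩ := exists_between hτρ
  have hR0 : 0 < R := hτ.trans hτR
  have hR1 : ρ * R < 1 := by rwa [lt_div_iff₀ hρ, mul_comm] at hRρ
  choose! s hs hsum using hser
  have hcont : ∀ t₀ ∈ Icc (-1 : ℝ) 1, ∀ m, Continuous fun q => s t₀ q m := fun t₀ ht₀ m => by
    refine continuous_coeff_of_hasSum (A := Icc (-1 : ℝ) 1) (f := f) (s := fun m q => s t₀ q m)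
      ?_ hρ hf (fun m q => hs t₀ ht₀ q m)
      (fun t ht h q => hsum t₀ ht₀ q t ht h) m
    exact mem_closure_iff_nhdsWithin_neBot.1 (mem_closure_Icc_diff_singleton ht₀)
  let σ : ℝ → ℕ → C(Q, ℂ) := fun t₀ m =>
    if h : t₀ ∈ Icc (-1 : ℝ) 1 then
      ⟨fun q => (s t₀ q m : ℂ), Complex.continuous_ofReal.comp (hcont t₀ h m)⟩ else 0
  have hσ : ∀ t₀ ∈ Icc (-1 : ℝ) 1, ∀ m q, σ t₀ m q = (s t₀ q m : ℂ) := fun t₀ h m q => by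
    simp only [σ, dif_pos h]; rfl
  -- If `Q` is empty, nothing forces C ≥ 0; hence the maximum.
  have hσn : ∀ t₀ ∈ Icc (-1 : ℝ) 1, ∀ m, ‖σ t₀ m‖ ≤ max C 0 * ρ ^ m := fun t₀ h m => by
    rw [ContinuousMap.norm_le _ (by positivity)]
    intro q
    rw [hσ t₀ h, Complex.norm_real, Real.norm_eq_abs]
    exact (hs t₀ h q m).trans (by gcongr; exact le_max_left _ _)
  let g : ℝ → C(Q, ℂ) := fun t =>
    if h : t ∈ Icc (-1 : ℝ) 1 then
      ⟨fun q => (f t q : ℂ), Complex.continuous_ofReal.comp (hf t h)⟩ else 0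
  have hg : ∀ t ∈ Icc (-1 : ℝ) 1, ∀ q, g t q = (f t q : ℂ) := fun t h q => by
    simp only [g, dif_pos h]; rfl
  obtain ⟨F, hF, hFg⟩ := exists_analytic_extension_sigmaRegion (g := g) hR0 hτR
    (G := fun t₀ z => ∑' m, (z - t₀) ^ m • σ t₀ m)
    (fun t₀ h => analyticOnNhd_tsum_smul hρ.le hR1 hR0 (hσn t₀ h) _) (by
      intro t₀ h₀ t ht htR
      have hlt : ρ * |t - t₀| < 1 := (mul_lt_mul_of_pos_left htR hρ).trans hR1
      have hsm : Summable fun m => ((t : ℂ) - t₀) ^ m • σ t₀ m := by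
        refine Summable.of_norm_bounded
          ((summable_geometric_of_lt_one (by positivity) hlt).mul_left (max C 0)) fun m => ?_
        rw [norm_smul, norm_pow, ← Complex.ofReal_sub, Complex.norm_real, Real.norm_eq_abs, mul_pow]
        calc _ ≤ |t - t₀| ^ m * (max C 0 * ρ ^ m) := by gcongr; exact hσn t₀ h₀ m
          _ = _ := by ring
      ext q
      rw [hg t ht, ← (ContinuousMap.hasSum_apply hsm.hasSum q).tsum_eq]
      have h2 := Complex.hasSum_ofReal.2 (hsum t₀ h₀ q t ht hlt)
      rw [← h2.tsum_eq]
      refine tsum_congr fun m => ?_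
      simp [hσ t₀ h₀, mul_comm])
  exact ⟨F, hF, fun t ht q => by rw [hFg t ht, hg t ht]⟩

end Extension

/-! ### Expansion of the energy after symmetric factorization -/

section Energy

/-- Power series expansion of the energy of the solutions of a perturbed variational problem, in
the case where the operator of the problem factors as `W S W`, with `S` a power series in the
perturbation parameter. -/
theorem exists_hasSum_energy {H : Type*} [NormedAddCommGroup H] [InnerProductSpace ℝ H]
    [CompleteSpace H] (V : Submodule ℝ H) (hV : IsClosed (V : Set H)) {W W' : H →L[ℝ] H}
    (hW : ∀ u v, ⟪W u, v⟫ = ⟪u, W v⟫) (hWW' : ∀ u, W (W' u) = u) (hW'W : ∀ u, W' (W u) = u)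
    {T : ℕ → H →L[ℝ] H} {c : ℝ} (hc : 0 ≤ c) (hT0 : T 0 = 1) (hT : ∀ i, ‖T i‖ ≤ c ^ i)
    {P P' G₀ : H} (hG₀P : G₀ - P ∈ V) (hG₀ : ∀ v ∈ V, ⟪W (W G₀), v⟫ = 0) :
    ∃ s : ℕ → ℝ, (∀ m, |s m| ≤ 2 * ‖W P‖ * ‖W P'‖ * (2 * c) ^ m) ∧
      ∀ (h : ℝ) (S : H →L[ℝ] H) (G G' : H), 2 * c * |h| < 1 → HasSum (fun i => h ^ i • T i) S →
        G - P ∈ V → G' - P' ∈ V → (∀ v ∈ V, ⟪W (S (W G)), v⟫ = 0) →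
        HasSum (fun m => s m * h ^ m) ⟪W (S (W G)), G'⟫ := by
  -- This is the image W V; writing it as a preimage under the inverse makes closedness immediate.
  let K : Submodule ℝ H := V.comap (W' : H →ₗ[ℝ] H)
  have hKmem : ∀ k, k ∈ K ↔ W' k ∈ V := fun k => Iff.rfl
  have hK : IsClosed (K : Set H) := hV.preimage W'.continuous
  have : CompleteSpace K := hK.completeSpace_coe
  have hWK : ∀ {v}, v ∈ V → W v ∈ K := fun {v} hv => by rwa [hKmem, hW'W]
  have horth : ∀ u, (∀ v ∈ V, ⟪W u, v⟫ = 0) → u ∈ Kᗮ := fun u hu k hk => by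
    rw [real_inner_comm, ← hWW' k, ← hW]
    exact hu _ hk
  have hU₀ : W G₀ ∈ Kᗮ := horth _ hG₀
  -- W G₀ is the part of W P orthogonal to K. This removes the solution from the bound and leaves
  -- only the datum P.
  have hnorm : ‖W G₀‖ ≤ ‖W P‖ := by
    have h1 : ⟪W G₀, W G₀ - W P⟫ = 0 := by
      rw [← map_sub, real_inner_comm]; exact hU₀ _ (hWK hG₀P)
    rw [inner_sub_right, sub_eq_zero, real_inner_self_eq_norm_sq] at h1
    have h2 := real_inner_le_norm (W G₀) (W P)
    rw [← h1] at h2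
    by_contra! h3
    nlinarith [norm_nonneg (W P)]
  refine ⟨fun m => ⟪∑ ij ∈ Finset.HasAntidiagonal.antidiagonal m,
    T ij.1 (galerkinCoeff K T (W G₀) ij.2), W P'⟫, fun m => ?_, ?_⟩
  · refine (abs_real_inner_le_norm _ _).trans ?_
    calc _ ≤ 2 * (2 * c) ^ m * ‖W G₀‖ * ‖W P'‖ := by
          gcongr; exact norm_sum_antidiagonal_galerkinCoeff_le K hc hT m
      _ ≤ 2 * (2 * c) ^ m * ‖W P‖ * ‖W P'‖ := by gcongr
      _ = _ := by ring
  · intro h S G G' hch hS hG hG' hSG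
    have hdiff : G - G₀ ∈ V := by simpa using V.sub_mem hG hG₀P
    have hSU : S (W G) ∈ Kᗮ := horth _ hSG
    have key := hasSum_inner_of_galerkin K hc hT0 hT hU₀ hK hch hS (U := W G)
      (by rw [← map_sub]; exact hWK hdiff) hSU (W P')
    -- G' - P' is an admissible test vector, so the second solution may be replaced by its fixed
    -- datum.
    have h0 : ⟪W (S (W G)), G'⟫ = ⟪S (W G), W P'⟫ := by
      rw [hW, ← sub_eq_zero, ← inner_sub_right, ← map_sub, real_inner_comm]
      exact hSU _ (hWK hG')
    rwa [h0]

end Energy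

/-! ### Taylor series of the coefficient and bounds valid at all parameters simultaneously -/

section Taylor

theorem hasSum_taylor_of_iteratedDerivWithin_le {f : ℝ → ℝ} {C c t₀ t : ℝ} (hc : 0 ≤ c)
    (hf : ContDiffOn ℝ ∞ f (Icc (-1 : ℝ) 1)) (ht₀ : t₀ ∈ Icc (-1 : ℝ) 1) (ht : t ∈ Icc (-1 : ℝ) 1)
    (hb : ∀ (m : ℕ), ∀ y ∈ Icc (-1 : ℝ) 1,
      |iteratedDerivWithin m f (Icc (-1 : ℝ) 1) y| ≤ c ^ m * m.factorial * C)
    (hct : c * |t - t₀| < 1) :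
    HasSum (fun m => (t - t₀) ^ m * (iteratedDerivWithin m f (Icc (-1 : ℝ) 1) t₀ / m.factorial))
      (f t) := by
  set I := Icc (-1 : ℝ) 1 with hI
  have hC : 0 ≤ C := by simpa using (abs_nonneg _).trans (hb 0 t₀ ht₀)
  have huI : UniqueDiffOn ℝ I := uniqueDiffOn_Icc (by norm_num)
  have hsm : Summable fun m : ℕ => (t - t₀) ^ m * (iteratedDerivWithin m f I t₀ / m.factorial) := by
    refine Summable.of_norm_bounded
      ((summable_geometric_of_lt_one (by positivity) hct).mul_right C) fun m => ?_
    rw [Real.norm_eq_abs, abs_mul, abs_pow, abs_div, Nat.abs_cast, mul_pow]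
    have : |iteratedDerivWithin m f I t₀| / m.factorial ≤ c ^ m * C := by
      rw [div_le_iff₀ (by positivity)]
      exact (hb m t₀ ht₀).trans_eq (by ring)
    calc _ ≤ |t - t₀| ^ m * (c ^ m * C) := by gcongr
      _ = _ := by ring
  rw [hsm.hasSum_iff_tendsto_nat, ← tendsto_add_atTop_iff_nat 1, tendsto_iff_norm_sub_tendsto_zero]
  have hlim : Tendsto (fun n : ℕ => C * c * |t - t₀| * ((n + 1) * (c * |t - t₀|) ^ n)) atTop
      (𝓝 (C * c * |t - t₀| * 0)) := by
    refine Tendsto.const_mul _ ?_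
    have h1 := tendsto_self_mul_const_pow_of_lt_one (r := c * |t - t₀|) (by positivity) hct
    have h2 := tendsto_pow_atTop_nhds_zero_of_lt_one (r := c * |t - t₀|) (by positivity) hct
    simpa [add_mul] using h1.add h2
  rw [mul_zero] at hlim
  refine squeeze_zero (fun _ => norm_nonneg _) (fun n => ?_) hlim
  have hsub : uIcc t₀ t ⊆ I := uIcc_subset_Icc ht₀ ht
  -- The mean value inequality is applied in the base point y of the Taylor polynomial, evaluated at
  -- fixed t. The y-derivative telescopes to the single term (t - y)^n f^(n+1)(y) / n!, and y = t
  -- returns f t. This treats both sides of t₀ at once.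
  have hmv := Convex.norm_image_sub_le_of_norm_hasDerivWithin_le (s := uIcc t₀ t)
    (f := fun y => taylorWithinEval f n I y t) (x := t₀) (y := t)
    (C := C * c * ((n + 1) * (c * |t - t₀|) ^ n))
    (fun y hy => (hasDerivWithinAt_taylorWithinEval_at_Icc t (by norm_num) (hsub hy)
      (hf.of_le (by exact_mod_cast le_top))
      (hf.differentiableOn_iteratedDerivWithin (by exact_mod_cast ENat.natCast_lt_top n) huI)).mono hsub)
    (fun y hy => by
      rw [norm_smul, Real.norm_eq_abs, Real.norm_eq_abs, abs_mul, abs_inv, Nat.abs_cast, abs_pow]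
      have hy' : |t - y| ≤ |t - t₀| := abs_sub_right_of_mem_uIcc hy
      calc _ ≤ ((n.factorial : ℝ)⁻¹ * |t - t₀| ^ n) * (c ^ (n + 1) * (n + 1).factorial * C) := by
            gcongr; exact hb _ y (hsub hy)
        _ = _ := by
            rw [Nat.factorial_succ, mul_pow]; push_cast; field_simp; ring)
    (convex_uIcc _ _) left_mem_uIcc right_mem_uIcc
  simp only [taylorWithinEval_self] at hmv
  rw [norm_sub_rev]
  have hT : taylorWithinEval f n I t₀ t = ∑ m ∈ Finset.range (n + 1),
      (t - t₀) ^ m * (iteratedDerivWithin m f I t₀ / m.factorial) := by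
    rw [taylor_within_apply]
    refine Finset.sum_congr rfl fun m _ => ?_
    rw [smul_eq_mul]; ring
  rw [hT, Real.norm_eq_abs (t - t₀)] at hmv
  exact hmv.trans_eq (by ring)

variable {X : Type*} [MeasurableSpace X] {μ : Measure X} {a : X → ℝ → ℝ}

/-- Each derivative is an a.e. limit of difference quotients of the previous one along a sequence in
[-1,1] avoiding t. -/
theorem aestronglyMeasurable_iteratedDerivWithin
    (hmeas : ∀ t ∈ Icc (-1 : ℝ) 1, AEStronglyMeasurable (fun x => a x t) μ)
    (hsmooth : ∀ᵐ x ∂μ, ContDiffOn ℝ ∞ (a x) (Icc (-1 : ℝ) 1)) (m : ℕ) :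
    ∀ t ∈ Icc (-1 : ℝ) 1,
      AEStronglyMeasurable (fun x => iteratedDerivWithin m (a x) (Icc (-1 : ℝ) 1) t) μ := by
  induction m with
  | zero => simpa using hmeas
  | succ m ih =>
    intro t ht
    obtain ⟨u, hu, hut⟩ := mem_closure_iff_seq_limit.1 (mem_closure_Icc_diff_singleton ht)
    refine aestronglyMeasurable_of_tendsto_ae atTop
      (f := fun n x => slope (iteratedDerivWithin m (a x) (Icc (-1 : ℝ) 1)) t (u n)) (fun n => ?_) ?_
    · simp only [slope, vsub_eq_sub, smul_eq_mul]
      exact ((ih _ (hu n).1).sub (ih t ht)).const_mul (u n - t)⁻¹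
    · filter_upwards [hsmooth] with x hx
      have hd := ((hx.differentiableOn_iteratedDerivWithin (m := m)
        (by exact_mod_cast ENat.natCast_lt_top m) (uniqueDiffOn_Icc (by norm_num))) t
        ht).hasDerivWithinAt
      rw [← iteratedDerivWithin_succ, hasDerivWithinAt_iff_tendsto_slope] at hd
      exact hd.comp (tendsto_nhdsWithin_iff.2 ⟨hut, Eventually.of_forall hu⟩)

/-- The exceptional null set in the hypotheses depends on t. A countable dense set of t needs only
one null set, and continuity of a(x,·) and its derivatives carries the non-strict inequalities to
the closure. -/
theorem ae_forall_bounds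
    (hsmooth : ∀ᵐ x ∂μ, ContDiffOn ℝ ∞ (a x) (Icc (-1 : ℝ) 1)) {κmin κmax : ℝ} (hκmin : 0 < κmin)
    (hbounds : ∀ t ∈ Icc (-1 : ℝ) 1, ∀ᵐ x ∂μ, κmin ≤ a x t ∧ a x t ≤ κmax) {c : ℝ} (hc : 0 ≤ c)
    (hgrowth : ∀ t ∈ Icc (-1 : ℝ) 1, ∀ m : ℕ,
      eLpNorm (fun x => iteratedDerivWithin m (a x) (Icc (-1 : ℝ) 1) t / a x t) ⊤ μ ≤
        ENNReal.ofReal (c ^ m * m.factorial)) :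
    ∀ᵐ x ∂μ, ∀ t ∈ Icc (-1 : ℝ) 1, (κmin ≤ a x t ∧ a x t ≤ κmax) ∧
      ∀ m : ℕ, |iteratedDerivWithin m (a x) (Icc (-1 : ℝ) 1) t| ≤ c ^ m * m.factorial * a x t := by
  obtain ⟨s, hsI, hsc, hs⟩ := (TopologicalSpace.IsSeparable.of_separableSpace
    (Icc (-1 : ℝ) 1)).exists_countable_dense_subset
  have h1 : ∀ᵐ x ∂μ, ∀ t ∈ s, κmin ≤ a x t ∧ a x t ≤ κmax :=
    (ae_ball_iff hsc).2 fun t ht => hbounds t (hsI ht)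
  have h2 : ∀ᵐ x ∂μ, ∀ t ∈ s, ∀ m : ℕ,
      |iteratedDerivWithin m (a x) (Icc (-1 : ℝ) 1) t| ≤ c ^ m * m.factorial * a x t := by
    refine (ae_ball_iff hsc).2 fun t ht => ae_all_iff.2 fun m => ?_
    filter_upwards [ae_le_eLpNormEssSup (f := fun x =>
      iteratedDerivWithin m (a x) (Icc (-1 : ℝ) 1) t / a x t) (μ := μ), hbounds t (hsI ht)]
      with x hx hxb
    have hg := hgrowth t (hsI ht) m
    rw [eLpNorm_exponent_top] at hg
    have h3 := hx.trans hg
    have hpos : 0 < a x t := hκmin.trans_le hxb.1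
    rw [← ofReal_norm, ENNReal.ofReal_le_ofReal_iff (by positivity), Real.norm_eq_abs,
      abs_div, abs_of_pos hpos, div_le_iff₀ hpos] at h3
    exact h3
  filter_upwards [hsmooth, h1, h2] with x hx hx1 hx2 t ht
  have hat : ContinuousWithinAt (a x) s t := (hx.continuousOn t ht).mono hsI
  refine ⟨⟨ContinuousWithinAt.closure_le (hs ht) continuousWithinAt_const hat fun y hy =>
    (hx1 y hy).1, ContinuousWithinAt.closure_le (hs ht) hat continuousWithinAt_const fun y hy =>
    (hx1 y hy).2⟩, fun m => ?_⟩
  have hm := ((hx.continuousOn_iteratedDerivWithin (m := m) (by exact_mod_cast le_top)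
    (uniqueDiffOn_Icc (by norm_num))) t ht).mono hsI
  exact ContinuousWithinAt.closure_le (hs ht) hm.abs (continuousWithinAt_const.mul hat)
    fun y hy => hx2 y hy m

end Taylor

/-! ### Multiplication operators on L² with bounded symbol -/

section Multiplication

variable {X : Type*} [MeasurableSpace X] {μ : Measure X}
  {E : Type*} [NormedAddCommGroup E] [InnerProductSpace ℝ E]

/-- The operator on `L²(μ; E)` of multiplication by an element of `L^∞(μ)`. -/
noncomputable def mulL : Lp ℝ ⊤ μ →L[ℝ] Lp E 2 μ →L[ℝ] Lp E 2 μ :=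
  (ContinuousLinearMap.lsmul ℝ ℝ : ℝ →L[ℝ] E →L[ℝ] E).holderL μ ⊤ 2 2

theorem coeFn_mulL (b : Lp ℝ ⊤ μ) (u : Lp E 2 μ) : mulL b u =ᵐ[μ] fun x => b x • u x :=
  (ContinuousLinearMap.lsmul ℝ ℝ : ℝ →L[ℝ] E →L[ℝ] E).coeFn_holder b u

theorem norm_mulL_le (b : Lp ℝ ⊤ μ) : ‖(mulL b : Lp E 2 μ →L[ℝ] Lp E 2 μ)‖ ≤ ‖b‖ := by
  refine ContinuousLinearMap.opNorm_le_bound _ (norm_nonneg _) fun u => ?_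
  refine ((ContinuousLinearMap.lsmul ℝ ℝ : ℝ →L[ℝ] E →L[ℝ] E).norm_holder_apply_apply_le
    b u).trans ?_
  have := ContinuousLinearMap.opNorm_lsmul_le (𝕜 := ℝ) (R := ℝ) (E := E)
  calc _ ≤ 1 * ‖b‖ * ‖u‖ := by gcongr
    _ = _ := by ring

theorem inner_mulL (b : Lp ℝ ⊤ μ) (u v : Lp E 2 μ) :
    ⟪mulL b u, v⟫ = ∫ x, b x * ⟪u x, v x⟫ ∂μ := by
  rw [L2.inner_def]
  refine integral_congr_ae ?_
  filter_upwards [coeFn_mulL b u] with x hx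
  rw [hx, real_inner_smul_left]

theorem inner_mulL_comm (b : Lp ℝ ⊤ μ) (u v : Lp E 2 μ) : ⟪mulL b u, v⟫ = ⟪u, mulL b v⟫ := by
  rw [real_inner_comm (mulL b v) u, inner_mulL, inner_mulL]
  exact integral_congr_ae (Eventually.of_forall fun x => by simp only [real_inner_comm])

theorem mulL_mulL {b b' b'' : Lp ℝ ⊤ μ} (h : ∀ᵐ x ∂μ, b x * b' x = b'' x) (u : Lp E 2 μ) :
    mulL b (mulL b' u) = mulL b'' u := by
  refine Lp.ext ?_
  filter_upwards [h, coeFn_mulL b (mulL b' u), coeFn_mulL b' u, coeFn_mulL b'' u] with x h h1 h2 h3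
  rw [h1, h2, h3, smul_smul, h]

theorem mulL_eq_self {b : Lp ℝ ⊤ μ} (h : ∀ᵐ x ∂μ, b x = 1) (u : Lp E 2 μ) : mulL b u = u := by
  refine Lp.ext ?_
  filter_upwards [h, coeFn_mulL b u] with x h h1
  rw [h1, h, one_smul]

theorem norm_Lp_top_le {b : Lp ℝ ⊤ μ} {C : ℝ} (hC : 0 ≤ C) (h : ∀ᵐ x ∂μ, |b x| ≤ C) : ‖b‖ ≤ C := by
  rw [Lp.norm_def, eLpNorm_exponent_top]
  refine ENNReal.toReal_le_of_le_ofReal hC (eLpNormEssSup_le_of_ae_bound ?_)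
  simpa using h

/-- The geometric tail estimate is the same for almost every x, so pointwise summation is summation
in the norm of `L^∞`. -/
theorem hasSum_Lp_top {β : ℕ → Lp ℝ ⊤ μ} {b : Lp ℝ ⊤ μ} {c h : ℝ} (hc : 0 ≤ c) (hch : c * |h| < 1)
    (hβ : ∀ i, ∀ᵐ x ∂μ, |β i x| ≤ c ^ i) (hb : ∀ᵐ x ∂μ, HasSum (fun i => h ^ i * β i x) (b x)) :
    HasSum (fun i => h ^ i • β i) b := by
  have hsm : Summable fun i => h ^ i • β i := by
    refine Summable.of_norm_bounded (summable_geometric_of_lt_one (r := c * |h|) (by positivity)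
      hch) fun i => ?_
    rw [norm_smul, norm_pow, Real.norm_eq_abs, mul_pow, mul_comm]
    gcongr
    exact norm_Lp_top_le (by positivity) (hβ i)
  rw [hsm.hasSum_iff_tendsto_nat, tendsto_iff_norm_sub_tendsto_zero]
  have hlim : Tendsto (fun n : ℕ => 1 * (c * |h|) ^ n / (1 - c * |h|)) atTop (𝓝 0) := by
    simpa using (tendsto_pow_atTop_nhds_zero_of_lt_one (r := c * |h|) (by positivity) hch).div_const
      (1 - c * |h|)
  refine squeeze_zero (fun _ => norm_nonneg _) (fun n => ?_) hlim
  refine norm_Lp_top_le (div_nonneg (by positivity) (by linarith)) ?_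
  have hsmul : ∀ᵐ x ∂μ, ∀ i, (h ^ i • β i : Lp ℝ ⊤ μ) x = h ^ i * β i x :=
    ae_all_iff.2 fun i => Lp.coeFn_smul _ _
  filter_upwards [Lp.coeFn_sub (∑ i ∈ Finset.range n, h ^ i • β i) b,
    Lp.coeFn_finsetSum (Finset.range n) (fun i => h ^ i • β i), hsmul, hb, ae_all_iff.2 hβ]
    with x h1 h2 h3 h4 h5
  rw [h1, Pi.sub_apply, h2, Finset.sum_apply, Finset.sum_congr rfl fun i _ => h3 i]
  refine norm_sub_le_of_geometric_bound_of_hasSum hch (fun i => ?_) h4 n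
  rw [Real.norm_eq_abs, abs_mul, abs_pow, mul_pow, one_mul, mul_comm]
  gcongr
  exact h5 i

end Multiplication

/-! ### The factorization κ(t) = √κ(t₀) · κ(t)/κ(t₀) · √κ(t₀) -/

section CoefficientFamily

variable {X : Type*} [MeasurableSpace X] {μ : Measure X}
  {E : Type*} [NormedAddCommGroup E] [InnerProductSpace ℝ E] [CompleteSpace E]

/-- Power series expansion, around any parameter in `[-1, 1]`, of the energy of the solutions of
variational problems with a coefficient whose parameter derivatives have factorial growth. -/
theorem exists_hasSum_energy_of_growth {a : X → ℝ → ℝ}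
    (hmeas : ∀ t ∈ Icc (-1 : ℝ) 1, AEStronglyMeasurable (fun x => a x t) μ)
    (hsmooth : ∀ᵐ x ∂μ, ContDiffOn ℝ ∞ (a x) (Icc (-1 : ℝ) 1)) {κmin κmax : ℝ} (hκmin : 0 < κmin)
    (hbounds : ∀ t ∈ Icc (-1 : ℝ) 1, ∀ᵐ x ∂μ, κmin ≤ a x t ∧ a x t ≤ κmax) {c : ℝ} (hc : 0 ≤ c)
    (hgrowth : ∀ t ∈ Icc (-1 : ℝ) 1, ∀ m : ℕ,
      eLpNorm (fun x => iteratedDerivWithin m (a x) (Icc (-1 : ℝ) 1) t / a x t) ⊤ μ ≤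
        ENNReal.ofReal (c ^ m * m.factorial))
    (V : Submodule ℝ (Lp E 2 μ)) (hV : IsClosed (V : Set (Lp E 2 μ))) (P P' : Lp E 2 μ)
    (G G' : ℝ → Lp E 2 μ) (hG : ∀ t ∈ Icc (-1 : ℝ) 1, G t - P ∈ V)
    (hG' : ∀ t ∈ Icc (-1 : ℝ) 1, G' t - P' ∈ V)
    (horth : ∀ t ∈ Icc (-1 : ℝ) 1, ∀ v ∈ V, ∫ x, a x t * ⟪G t x, v x⟫ ∂μ = 0)
    {t₀ : ℝ} (ht₀ : t₀ ∈ Icc (-1 : ℝ) 1) :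
    ∃ s : ℕ → ℝ, (∀ m, |s m| ≤ 2 * (√κmax * ‖P‖) * (√κmax * ‖P'‖) * (2 * c) ^ m) ∧
      ∀ t ∈ Icc (-1 : ℝ) 1, 2 * c * |t - t₀| < 1 →
        HasSum (fun m => s m * (t - t₀) ^ m) (∫ x, a x t * ⟪G t x, G' t x⟫ ∂μ) := by
  have hall := ae_forall_bounds hsmooth hκmin hbounds hc hgrowth
  have hdm := aestronglyMeasurable_iteratedDerivWithin hmeas hsmooth
  have ham := hmeas t₀ ht₀
  have hwb : ∀ᵐ x ∂μ, ‖√(a x t₀)‖ ≤ √κmax := by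
    filter_upwards [hall] with x hx
    rw [Real.norm_of_nonneg (Real.sqrt_nonneg _)]
    exact Real.sqrt_le_sqrt (hx t₀ ht₀).1.2
  have hwm : MemLp (fun x => √(a x t₀)) ⊤ μ :=
    memLp_top_of_bound (Real.continuous_sqrt.comp_aestronglyMeasurable ham) _ hwb
  have hw'm : MemLp (fun x => (√(a x t₀))⁻¹) ⊤ μ := by
    refine memLp_top_of_bound
      (Real.continuous_sqrt.comp_aestronglyMeasurable ham).aemeasurable.inv.aestronglyMeasurable
      (√κmin)⁻¹ ?_
    filter_upwards [hall] with x hx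
    rw [norm_inv, Real.norm_of_nonneg (Real.sqrt_nonneg _)]
    exact inv_anti₀ (Real.sqrt_pos.2 hκmin) (Real.sqrt_le_sqrt (hx t₀ ht₀).1.1)
  -- These are the symbols of the Tᵢ, the Taylor coefficients of a(x,t)/a(x,t₀). The relative form
  -- of the growth hypothesis gives cⁱ with no ellipticity constant.
  have hβb : ∀ i : ℕ, ∀ᵐ x ∂μ,
      ‖iteratedDerivWithin i (a x) (Icc (-1 : ℝ) 1) t₀ / i.factorial / a x t₀‖ ≤ c ^ i := fun i => by
    filter_upwards [hall] with x hx
    have hpos : 0 < a x t₀ := hκmin.trans_le (hx t₀ ht₀).1.1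
    rw [Real.norm_eq_abs, abs_div, abs_div, abs_of_pos hpos, Nat.abs_cast, div_le_iff₀ hpos,
      div_le_iff₀ (by positivity)]
    exact ((hx t₀ ht₀).2 i).trans_eq (by ring)
  have hβm : ∀ i : ℕ, MemLp
      (fun x => iteratedDerivWithin i (a x) (Icc (-1 : ℝ) 1) t₀ / i.factorial / a x t₀) ⊤ μ :=
    fun i => memLp_top_of_bound
      (((hdm i t₀ ht₀).aemeasurable.div_const _).div ham.aemeasurable).aestronglyMeasurable _
      (hβb i)
  have hbm : ∀ t ∈ Icc (-1 : ℝ) 1, MemLp (fun x => a x t / a x t₀) ⊤ μ := fun t ht => by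
    refine memLp_top_of_bound ((hmeas t ht).aemeasurable.div ham.aemeasurable).aestronglyMeasurable
      (κmax / κmin) ?_
    filter_upwards [hall] with x hx
    have hpos : 0 < a x t₀ := hκmin.trans_le (hx t₀ ht₀).1.1
    have hpos' : 0 < a x t := hκmin.trans_le (hx t ht).1.1
    rw [Real.norm_eq_abs, abs_div, abs_of_pos hpos, abs_of_pos hpos']
    exact div_le_div₀ (hpos'.le.trans (hx t ht).1.2) (hx t ht).1.2 hκmin (hx t₀ ht₀).1.1
  have hαm : ∀ t ∈ Icc (-1 : ℝ) 1, MemLp (fun x => a x t) ⊤ μ := fun t ht => by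
    refine memLp_top_of_bound (hmeas t ht) κmax ?_
    filter_upwards [hall] with x hx
    have hpos' : 0 < a x t := hκmin.trans_le (hx t ht).1.1
    rw [Real.norm_eq_abs, abs_of_pos hpos']
    exact (hx t ht).1.2
  set w := hwm.toLp
  set w' := hw'm.toLp
  have hone : ∀ᵐ x ∂μ, √(a x t₀) ≠ 0 := by
    filter_upwards [hall] with x hx using
      (Real.sqrt_pos.2 (hκmin.trans_le (hx t₀ ht₀).1.1)).ne'
  have hmw : (memLp_top_const (1 : ℝ) : MemLp (fun _ => (1 : ℝ)) ⊤ μ).toLp =ᵐ[μ] fun _ => (1 : ℝ) :=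
    MemLp.coeFn_toLp _
  have hfac : ∀ (t : ℝ) (ht : t ∈ Icc (-1 : ℝ) 1) (u : Lp E 2 μ),
      mulL w (mulL (hbm t ht).toLp (mulL w u)) = mulL (hαm t ht).toLp u := fun t ht u => by
    refine Lp.ext ?_
    filter_upwards [hall, hwm.coeFn_toLp, (hbm t ht).coeFn_toLp, (hαm t ht).coeFn_toLp,
      coeFn_mulL w (mulL (hbm t ht).toLp (mulL w u)), coeFn_mulL (hbm t ht).toLp (mulL w u),
      coeFn_mulL w u, coeFn_mulL (hαm t ht).toLp u] with x hx h1 h2 h3 h4 h5 h6 h7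
    have hpos : 0 < a x t₀ := hκmin.trans_le (hx t₀ ht₀).1.1
    rw [h4, h5, h6, h7, h1, h2, h3, smul_smul, smul_smul]
    congr 1
    rw [mul_comm, ← mul_assoc, Real.mul_self_sqrt hpos.le]
    field_simp
  have hint : ∀ (t : ℝ) (ht : t ∈ Icc (-1 : ℝ) 1) (u v : Lp E 2 μ),
      ⟪mulL (hαm t ht).toLp u, v⟫ = ∫ x, a x t * ⟪u x, v x⟫ ∂μ := fun t ht u v => by
    rw [inner_mulL]
    refine integral_congr_ae ?_
    filter_upwards [(hαm t ht).coeFn_toLp] with x hx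
    rw [hx]
  have hb₀ : ∀ u : Lp E 2 μ, mulL (hbm t₀ ht₀).toLp u = u := fun u => by
    refine mulL_eq_self ?_ u
    filter_upwards [(hbm t₀ ht₀).coeFn_toLp, hall] with x h1 hx
    rw [h1, div_self (hκmin.trans_le (hx t₀ ht₀).1.1).ne']
  have hwn : ∀ u : Lp E 2 μ, ‖mulL w u‖ ≤ √κmax * ‖u‖ := fun u => by
    refine ContinuousLinearMap.le_of_opNorm_le _ ((norm_mulL_le w).trans
      (norm_Lp_top_le (Real.sqrt_nonneg _) ?_)) u
    filter_upwards [hwb, hwm.coeFn_toLp] with x h1 h2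
    rw [h2]; exact h1
  have hT0 : (mulL (hβm 0).toLp : Lp E 2 μ →L[ℝ] Lp E 2 μ) = 1 := by
    ext1 u
    refine mulL_eq_self ?_ u
    filter_upwards [(hβm 0).coeFn_toLp, hall] with x h1 hx
    rw [h1]
    simp [(hκmin.trans_le (hx t₀ ht₀).1.1).ne']
  obtain ⟨s, hs, hsum⟩ := exists_hasSum_energy V hV (W := mulL w) (W' := mulL w')
    (T := fun i => mulL (hβm i).toLp) (P := P) (P' := P') (G₀ := G t₀)
    (inner_mulL_comm w)
    (fun u => by
      rw [mulL_mulL (b'' := (memLp_top_const (1 : ℝ)).toLp), mulL_eq_self hmw]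
      filter_upwards [hone, hmw, hwm.coeFn_toLp, hw'm.coeFn_toLp] with x h1 h2 h3 h4
      rw [h2, h3, h4, mul_inv_cancel₀ h1])
    (fun u => by
      rw [mulL_mulL (b'' := (memLp_top_const (1 : ℝ)).toLp), mulL_eq_self hmw]
      filter_upwards [hone, hmw, hwm.coeFn_toLp, hw'm.coeFn_toLp] with x h1 h2 h3 h4
      rw [h2, h3, h4, inv_mul_cancel₀ h1])
    hc hT0
    (fun i => (norm_mulL_le _).trans (norm_Lp_top_le (by positivity) (by
      filter_upwards [hβb i, (hβm i).coeFn_toLp] with x h1 h2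
      rw [h2]; exact h1)))
    (hG t₀ ht₀)
    (fun v hv => by
      have h1 := hfac t₀ ht₀ (G t₀)
      rw [hb₀] at h1
      rw [h1, hint t₀ ht₀]
      exact horth t₀ ht₀ v hv)
  refine ⟨s, fun m => (hs m).trans ?_, fun t ht htt => ?_⟩
  · gcongr
    · exact hwn P
    · exact hwn P'
  · rw [← hint t ht, ← hfac t ht]
    refine hsum (t - t₀) (mulL (hbm t ht).toLp) (G t) (G' t) htt ?_ (hG t ht) (hG' t ht)
      (fun v hv => by rw [hfac t ht, hint t ht]; exact horth t ht v hv)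
    have hct : c * |t - t₀| < 1 := by nlinarith [mul_nonneg hc (abs_nonneg (t - t₀))]
    have h1 : HasSum (fun i => (t - t₀) ^ i • (hβm i).toLp) (hbm t ht).toLp := by
      refine hasSum_Lp_top hc hct (fun i => ?_) ?_
      · filter_upwards [hβb i, (hβm i).coeFn_toLp] with x h1 h2
        rw [h2]; exact h1
      · filter_upwards [hsmooth, hall, (hbm t ht).coeFn_toLp,
          ae_all_iff.2 fun i => (hβm i).coeFn_toLp] with x hx hxb h2 h3
        -- The bound κmax serves only to prove convergence here; it does not enter the estimate of
        -- the Tᵢ.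
        have h4 := hasSum_taylor_of_iteratedDerivWithin_le (C := κmax) hc hx ht₀ ht (fun m y hy =>
          ((hxb y hy).2 m).trans (by gcongr; exact (hxb y hy).1.2)) hct
        rw [h2]
        simpa only [h3, mul_div_assoc] using h4.div_const (a x t₀)
    have h2 := h1.mapL (mulL : Lp ℝ ⊤ μ →L[ℝ] Lp E 2 μ →L[ℝ] Lp E 2 μ)
    simpa only [map_smul] using h2

end CoefficientFamily

/-! ### Weak gradients and the closed space of test gradients -/

section Sobolev

variable {d : ℕ} {D : Set (Space d)} {ψ u v : Space d → ℝ} {G G' : Space d → Space d}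

theorem IsTestFunction.continuous (hψ : IsTestFunction D ψ) : Continuous ψ := hψ.1.continuous

theorem IsTestFunction.differentiable (hψ : IsTestFunction D ψ) : Differentiable ℝ ψ :=
  hψ.1.differentiable (by simp)

theorem IsTestFunction.continuous_gradient (hψ : IsTestFunction D ψ) : Continuous (gradient ψ) :=
  (InnerProductSpace.toDual ℝ (Space d)).symm.continuous.comp
    (hψ.1.continuous_fderiv (by simp))

theorem tsupport_gradient_subset (ψ : Space d → ℝ) : tsupport (gradient ψ) ⊆ tsupport ψ := by
  refine closure_minimal (fun x hx => ?_) (isClosed_tsupport ψ)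
  refine support_fderiv_subset ℝ fun h => hx ?_
  simp [gradient, h]

theorem IsTestFunction.hasCompactSupport_gradient (hψ : IsTestFunction D ψ) :
    HasCompactSupport (gradient ψ) :=
  hψ.2.1.of_isClosed_subset (isClosed_tsupport _) (tsupport_gradient_subset ψ)

theorem IsTestFunction.memLp (hψ : IsTestFunction D ψ) : MemLp ψ 2 (volume.restrict D) :=
  hψ.continuous.memLp_of_hasCompactSupport hψ.2.1

theorem IsTestFunction.memLp_gradient (hψ : IsTestFunction D ψ) :
    MemLp (gradient ψ) 2 (volume.restrict D) :=
  hψ.continuous_gradient.memLp_of_hasCompactSupport hψ.hasCompactSupport_gradient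

theorem IsTestFunction.integrableOn_smul (hψ : IsTestFunction D ψ) (hG : LocallyIntegrableOn G D) :
    IntegrableOn (fun x => ψ x • G x) D := by
  have h := (hG.integrableOn_compact_subset hψ.2.2 hψ.2.1).continuousOn_smul
    hψ.continuous.continuousOn hψ.2.1
  refine ((integrableOn_iff_integrable_of_support_subset fun x hx => ?_).1 h).integrableOn
  exact subset_tsupport ψ fun h0 => hx (by simp [h0])

theorem IsTestFunction.integrableOn_smul_gradient (hψ : IsTestFunction D ψ)
    (hu : LocallyIntegrableOn u D) : IntegrableOn (fun x => u x • gradient ψ x) D := by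
  have h := (hu.integrableOn_compact_subset hψ.2.2 hψ.2.1).smul_continuousOn
    hψ.continuous_gradient.continuousOn hψ.2.1
  refine ((integrableOn_iff_integrable_of_support_subset fun x hx => ?_).1 h).integrableOn
  exact tsupport_gradient_subset ψ (subset_tsupport _ fun h0 => hx (by simp [h0]))

theorem HasWeakGradient.sub (hu : HasWeakGradient D u G) (hv : HasWeakGradient D v G') :
    HasWeakGradient D (fun x => u x - v x) (fun x => G x - G' x) := by
  refine ⟨hu.1.sub hv.1, hu.2.1.sub hv.2.1, fun ψ hψ => ?_⟩
  simp only [sub_smul, smul_sub]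
  rw [integral_sub (hψ.integrableOn_smul_gradient hu.1) (hψ.integrableOn_smul_gradient hv.1),
    integral_sub (hψ.integrableOn_smul hu.2.1) (hψ.integrableOn_smul hv.2.1), hu.2.2 ψ hψ,
    hv.2.2 ψ hψ]
  abel

/-- Weak gradients are unique up to null sets. -/
theorem HasWeakGradient.ae_eq (hD : IsOpen D) (hG : HasWeakGradient D u G)
    (hG' : HasWeakGradient D u G') : G =ᵐ[volume.restrict D] G' := by
  have h := hD.ae_eq_zero_of_integral_contDiff_smul_eq_zero (μ := volume) (f := G - G')
    (hG.2.1.sub hG'.2.1) fun ψ h1 h2 h3 => by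
      have hψ : IsTestFunction D ψ := ⟨h1, h2, h3⟩
      rw [← setIntegral_eq_integral_of_forall_compl_eq_zero (s := D) fun x hx => by
        rw [image_eq_zero_of_notMem_tsupport fun h => hx (h3 h), zero_smul]]
      simp only [Pi.sub_apply, smul_sub]
      rw [integral_sub (hψ.integrableOn_smul hG.2.1) (hψ.integrableOn_smul hG'.2.1), sub_eq_zero]
      exact neg_injective ((hG.2.2 ψ hψ).symm.trans (hG'.2.2 ψ hψ))
  filter_upwards [(ae_restrict_iff' hD.measurableSet).2 h] with x hx using sub_eq_zero.1 hx

theorem HasWeakGradient.weakGradient_ae_eq (hD : IsOpen D) (hG : HasWeakGradient D u G) :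
    weakGradient D u =ᵐ[volume.restrict D] G := by
  have h : ∃ G, HasWeakGradient D u G := ⟨G, hG⟩
  rw [weakGradient, dif_pos h]
  exact h.choose_spec.ae_eq hD hG

theorem MemH1.memLp_weakGradient (hD : IsOpen D) (hu : MemH1 D u) :
    MemLp (weakGradient D u) 2 (volume.restrict D) := by
  obtain ⟨-, G, hG, hG2⟩ := hu
  exact (memLp_congr_ae (hG.weakGradient_ae_eq hD)).2 hG2

theorem weakGradient_sub_ae_eq (hD : IsOpen D) (hu : MemH1 D u) (hv : MemH1 D v) :
    weakGradient D (fun x => u x - v x) =ᵐ[volume.restrict D]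
      fun x => weakGradient D u x - weakGradient D v x := by
  obtain ⟨-, G, hG, -⟩ := hu
  obtain ⟨-, G', hG', -⟩ := hv
  filter_upwards [(hG.sub hG').weakGradient_ae_eq hD, hG.weakGradient_ae_eq hD,
    hG'.weakGradient_ae_eq hD] with x h1 h2 h3
  rw [h1, h2, h3]

theorem IsTestFunction.hasWeakGradient (hψ : IsTestFunction D ψ) :
    HasWeakGradient D ψ (gradient ψ) := by
  refine ⟨hψ.continuous.locallyIntegrable.locallyIntegrableOn D,
    hψ.continuous_gradient.locallyIntegrable.locallyIntegrableOn D, fun χ hχ => ?_⟩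
  have h1 : Integrable fun x => ψ x • gradient χ x :=
    (hψ.continuous.smul hχ.continuous_gradient).integrable_of_hasCompactSupport
      (hψ.2.1.smul_right)
  have h2 : Integrable fun x => χ x • gradient ψ x :=
    (hχ.continuous.smul hψ.continuous_gradient).integrable_of_hasCompactSupport
      (hχ.2.1.smul_right)
  rw [setIntegral_eq_integral_of_forall_compl_eq_zero fun x hx => by
      rw [image_eq_zero_of_notMem_tsupport fun h => hx (hψ.2.2 h), zero_smul],
    setIntegral_eq_integral_of_forall_compl_eq_zero fun x hx => by
      rw [image_eq_zero_of_notMem_tsupport fun h => hx (hχ.2.2 h), zero_smul]]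
  -- Pairing with a fixed direction w reduces the vector identity to scalar integration by parts for
  -- the derivative along w.
  refine ext_inner_left ℝ fun w => ?_
  rw [inner_neg_right, ← integral_inner h1, ← integral_inner h2]
  have e1 : ∀ x, ⟪w, ψ x • gradient χ x⟫ = ψ x * fderiv ℝ χ x w := fun x => by
    rw [real_inner_smul_right, real_inner_comm, inner_gradient_left]
  have e2 : ∀ x, ⟪w, χ x • gradient ψ x⟫ = fderiv ℝ ψ x w * χ x := fun x => by
    rw [real_inner_smul_right, real_inner_comm, inner_gradient_left, mul_comm]
  have i1 := h1.const_inner (𝕜 := ℝ) w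
  have i2 := h2.const_inner (𝕜 := ℝ) w
  simp only [e1] at i1 ⊢
  simp only [e2] at i2 ⊢
  exact integral_mul_fderiv_eq_neg_fderiv_mul_of_integrable i2 i1
    ((hψ.continuous.mul hχ.continuous).integrable_of_hasCompactSupport hψ.2.1.mul_right)
    (fun x _ => hψ.differentiable x) (fun x _ => hχ.differentiable x)

theorem IsTestFunction.memH10 (hD : IsOpen D) (hψ : IsTestFunction D ψ) : MemH10 D ψ := by
  refine ⟨⟨hψ.memLp, gradient ψ, hψ.hasWeakGradient, hψ.memLp_gradient⟩, fun _ => ψ, fun _ => hψ,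
    by simp, ?_⟩
  have h : (fun x => weakGradient D ψ x - gradient ψ x) =ᵐ[volume.restrict D] 0 := by
    filter_upwards [hψ.hasWeakGradient.weakGradient_ae_eq hD] with x hx
    simp [hx]
  simp [eLpNorm_congr_ae h]

/-- The closure in `L²(D)` of the gradients of test functions. -/
noncomputable def gradientSpace (D : Set (Space d)) :
    Submodule ℝ (Lp (Space d) 2 (volume.restrict D)) :=
  (Submodule.span ℝ {g | ∃ (ψ : Space d → ℝ) (hψ : IsTestFunction D ψ),
    g = hψ.memLp_gradient.toLp}).topologicalClosure

theorem isClosed_gradientSpace (D : Set (Space d)) :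
    IsClosed (gradientSpace D : Set (Lp (Space d) 2 (volume.restrict D))) :=
  Submodule.isClosed_topologicalClosure _

theorem MemH10.toLp_weakGradient_mem (hu : MemH10 D u)
    (hm : MemLp (weakGradient D u) 2 (volume.restrict D)) : hm.toLp ∈ gradientSpace D := by
  obtain ⟨-, ψ, hψ, -, hlim⟩ := hu
  have h := (Lp.tendsto_Lp_iff_tendsto_eLpNorm'' (fun j => gradient (ψ j))
    (fun j => (hψ j).memLp_gradient) (weakGradient D u) hm (fi := atTop)).2 (by
      refine hlim.congr fun j => ?_
      rw [← eLpNorm_neg]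
      congr 1
      ext x
      simp)
  exact (isClosed_gradientSpace D).mem_of_tendsto h (Eventually.of_forall fun j =>
    Submodule.le_topologicalClosure _ (Submodule.subset_span ⟨ψ j, hψ j, rfl⟩))

theorem IsCellSolution.toLp_sub_mem (hD : IsOpen D) {a p : Space d → ℝ}
    (h : IsCellSolution D a p u) (hp : MemH1 D p) :
    (h.1.memLp_weakGradient hD).toLp - (hp.memLp_weakGradient hD).toLp ∈ gradientSpace D := by
  have h1 := h.2.1.toLp_weakGradient_mem (h.2.1.1.memLp_weakGradient hD)
  rw [← MemLp.toLp_sub]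
  convert h1 using 1
  exact (MemLp.toLp_eq_toLp_iff _ _).2 (weakGradient_sub_ae_eq hD h.1 hp).symm

/-- The weighted pairing is a continuous functional that vanishes on gradients of test functions,
hence on their closed span. Elements of that span need not be identified as gradients of H¹₀
functions. -/
theorem IsCellSolution.integral_eq_zero (hD : IsOpen D) {a p : Space d → ℝ} {C : ℝ}
    (ham : AEStronglyMeasurable a (volume.restrict D)) (haC : ∀ᵐ x ∂volume.restrict D, |a x| ≤ C)
    (h : IsCellSolution D a p u) (v : Lp (Space d) 2 (volume.restrict D))
    (hv : v ∈ gradientSpace D) :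
    ∫ x in D, a x * ⟪((h.1.memLp_weakGradient hD).toLp : Lp (Space d) 2 (volume.restrict D)) x,
      v x⟫ = 0 := by
  set U := (h.1.memLp_weakGradient hD).toLp with hU
  have hα : MemLp a ⊤ (volume.restrict D) := memLp_top_of_bound ham C haC
  have hint : ∀ w : Lp (Space d) 2 (volume.restrict D),
      ∫ x in D, a x * ⟪U x, w x⟫ = innerSL ℝ (mulL hα.toLp U) w := fun w => by
    rw [innerSL_apply_apply, inner_mulL]
    refine integral_congr_ae ?_
    filter_upwards [hα.coeFn_toLp] with x hx
    rw [hx]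
  rw [hint]
  refine Submodule.topologicalClosure_minimal (t := (innerSL ℝ (mulL hα.toLp U)).ker) _ ?_
    (ContinuousLinearMap.isClosed_ker _) hv
  rw [Submodule.span_le]
  rintro _ ⟨ψ, hψ, rfl⟩
  change innerSL ℝ (mulL hα.toLp U) _ = 0
  rw [← hint, ← h.2.2 ψ (hψ.memH10 hD), energyForm]
  refine integral_congr_ae ?_
  filter_upwards [hψ.memLp_gradient.coeFn_toLp, hψ.hasWeakGradient.weakGradient_ae_eq hD,
    (h.1.memLp_weakGradient hD).coeFn_toLp] with x h1 h2 h3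
  rw [h1, h2, hU, h3]

end Sobolev

/-! ### Continuity of the energy under bounded a.e. convergence of coefficients -/

section Continuity

variable {X : Type*} [MeasurableSpace X] {μ : Measure X}
  {E : Type*} [NormedAddCommGroup E] [InnerProductSpace ℝ E]

theorem norm_sq_mulL (b : Lp ℝ ⊤ μ) (u : Lp E 2 μ) :
    ‖mulL b u‖ ^ 2 = ∫ x, b x ^ 2 * ‖u x‖ ^ 2 ∂μ := by
  rw [← real_inner_self_eq_norm_sq, inner_mulL]
  refine integral_congr_ae ?_
  filter_upwards [coeFn_mulL b u] with x hx
  rw [hx, real_inner_smul_right, real_inner_self_eq_norm_sq]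
  ring

/-- Dominated convergence for a fixed u. The multiplication operators converge only strongly, since
the symbols need not converge in `L^∞`. -/
theorem tendsto_mulL_sub_of_ae_tendsto {α : ℕ → Lp ℝ ⊤ μ} {α₀ : Lp ℝ ⊤ μ} {C : ℝ}
    (hα : ∀ j, ∀ᵐ x ∂μ, |α j x| ≤ C) (hα₀ : ∀ᵐ x ∂μ, |α₀ x| ≤ C)
    (hlim : ∀ᵐ x ∂μ, Tendsto (fun j => α j x) atTop (𝓝 (α₀ x))) (u : Lp E 2 μ) :
    Tendsto (fun j => ‖mulL (α j - α₀) u‖) atTop (𝓝 0) := by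
  have hsub : ∀ᵐ x ∂μ, ∀ j, (α j - α₀ : Lp ℝ ⊤ μ) x = α j x - α₀ x :=
    ae_all_iff.2 fun j => Lp.coeFn_sub _ _
  have h : Tendsto (fun j => ‖mulL (α j - α₀) u‖ ^ 2) atTop (𝓝 0) := by
    simp only [norm_sq_mulL]
    have hu : Integrable (fun x => ‖u x‖ ^ 2) μ := (Lp.memLp u).integrable_norm_pow two_ne_zero
    have := tendsto_integral_of_dominated_convergence (μ := μ)
      (F := fun j x => (α j - α₀ : Lp ℝ ⊤ μ) x ^ 2 * ‖u x‖ ^ 2) (f := fun _ => (0 : ℝ))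
      (fun x => (2 * C) ^ 2 * ‖u x‖ ^ 2)
      (fun j => ((Lp.aestronglyMeasurable _).pow 2).mul hu.aestronglyMeasurable)
      (hu.const_mul _)
      (fun j => by
        filter_upwards [hsub, hα j, hα₀] with x h1 h2 h3
        rw [Real.norm_of_nonneg (by positivity), h1]
        have h4 : |α j x - α₀ x| ≤ 2 * C := (abs_sub _ _).trans (by linarith)
        rw [← sq_abs (α j x - α₀ x)]
        gcongr)
      (by
        filter_upwards [hsub, hlim] with x h1 h2
        simp only [h1]
        simpa using ((h2.sub_const (α₀ x)).pow 2).mul_const (‖u x‖ ^ 2))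
    simpa using this
  simpa using h.sqrt

/-- The energy of the solutions of variational problems depends continuously on the coefficient,
with respect to bounded almost everywhere convergence. -/
theorem tendsto_energy {α : ℕ → Lp ℝ ⊤ μ} {α₀ : Lp ℝ ⊤ μ} {κmin C : ℝ} (hκmin : 0 < κmin)
    (hα : ∀ j, ∀ᵐ x ∂μ, κmin ≤ α j x ∧ α j x ≤ C) (hα₀ : ∀ᵐ x ∂μ, |α₀ x| ≤ C)
    (hlim : ∀ᵐ x ∂μ, Tendsto (fun j => α j x) atTop (𝓝 (α₀ x)))
    (V : Submodule ℝ (Lp E 2 μ)) {P P' : Lp E 2 μ} {G G' : ℕ → Lp E 2 μ} {G₀ G₀' : Lp E 2 μ}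
    (hG : ∀ j, G j - P ∈ V) (hG' : ∀ j, G' j - P' ∈ V) (hG₀ : G₀ - P ∈ V) (hG₀' : G₀' - P' ∈ V)
    (horth : ∀ j, ∀ v ∈ V, ⟪mulL (α j) (G j), v⟫ = 0)
    (horth₀' : ∀ v ∈ V, ⟪mulL α₀ G₀', v⟫ = 0) :
    Tendsto (fun j => ⟪mulL (α j) (G j), G' j⟫) atTop (𝓝 ⟪mulL α₀ G₀, G₀'⟫) := by
  have habs : ∀ j, ∀ᵐ x ∂μ, |α j x| ≤ C := fun j => by
    filter_upwards [hα j] with x hx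
    rw [abs_of_pos (hκmin.trans_le hx.1)]
    exact hx.2
  -- A priori bound from ellipticity, after testing with G j - P.
  have hGb : ∀ j, ‖G j‖ ≤ max C 0 / κmin * ‖P‖ := fun j => by
    have h1 : κmin * ‖G j‖ ^ 2 ≤ ⟪mulL (α j) (G j), G j⟫ := by
      have hint := (L2.integrable_inner (𝕜 := ℝ) (mulL (α j) (G j)) (G j))
      rw [← real_inner_self_eq_norm_sq, L2.inner_def, L2.inner_def, ← integral_const_mul]
      refine integral_mono_ae ((L2.integrable_inner (𝕜 := ℝ) (G j) (G j)).const_mul _) hint ?_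
      filter_upwards [coeFn_mulL (α j) (G j), hα j] with x h1 h2
      simp only [h1, real_inner_smul_left]
      gcongr
      · exact real_inner_self_nonneg
      · exact h2.1
    have h2 : ⟪mulL (α j) (G j), G j⟫ = ⟪mulL (α j) (G j), P⟫ := by
      rw [← sub_eq_zero, ← inner_sub_right]; exact horth j _ (hG j)
    have h3 : ⟪mulL (α j) (G j), P⟫ ≤ max C 0 * ‖G j‖ * ‖P‖ := by
      refine (real_inner_le_norm _ _).trans ?_
      gcongr
      exact ContinuousLinearMap.le_of_opNorm_le _ ((norm_mulL_le _).trans (norm_Lp_top_le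
        (le_max_right _ _) ((habs j).mono fun x hx => hx.trans (le_max_left _ _)))) _
    rcases (norm_nonneg (G j)).eq_or_lt with h0 | h0
    · rw [← h0]; positivity
    · rw [div_mul_eq_mul_div, le_div_iff₀ hκmin]
      refine le_of_mul_le_mul_right ?_ h0
      nlinarith
  -- Both orthogonality relations reduce the difference to the coefficient error acting on the fixed
  -- limit solution. Boundedness of G j is then enough; its convergence is not needed.
  have hdiff : ∀ j, ⟪mulL (α j) (G j), G' j⟫ - ⟪mulL α₀ G₀, G₀'⟫ =
      ⟪G j, mulL (α j - α₀) G₀'⟫ := fun j => by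
    have h1 : ⟪mulL (α j) (G j), G' j⟫ = ⟪mulL (α j) (G j), G₀'⟫ := by
      rw [← sub_eq_zero, ← inner_sub_right]
      exact horth j _ (by simpa using V.sub_mem (hG' j) hG₀')
    have h2 : ⟪mulL α₀ G₀, G₀'⟫ = ⟪G j, mulL α₀ G₀'⟫ := by
      rw [inner_mulL_comm, real_inner_comm, real_inner_comm _ (G j), ← sub_eq_zero,
        ← inner_sub_right]
      exact horth₀' _ (by simpa using V.sub_mem hG₀ (hG j))
    rw [h1, h2, map_sub, sub_apply, inner_sub_right, inner_mulL_comm]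
  rw [tendsto_iff_norm_sub_tendsto_zero]
  have hbound := (tendsto_mulL_sub_of_ae_tendsto habs hα₀ hlim G₀').const_mul
    (max C 0 / κmin * ‖P‖)
  rw [mul_zero] at hbound
  refine squeeze_zero (fun _ => norm_nonneg _) (fun j => ?_) hbound
  rw [hdiff]
  exact (norm_inner_le_norm _ _).trans (by gcongr; exact hGb j)

end Continuity

/-! ### Splitting off one parameter -/

section Parameters

variable {n : ℕ} (k : Fin (n + 1))

theorem joinParam_mem_paramCube {t : ℝ} (ht : t ∈ Icc (-1 : ℝ) 1) (η : Fin n → Icc (-1 : ℝ) 1) :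
    joinParam k t η ∈ paramCube (n + 1) := by
  intro j
  revert j
  rw [Fin.forall_iff_succAbove k]
  refine ⟨?_, fun i => ?_⟩
  · simpa only [joinParam, Fin.insertNth_apply_same] using ht
  · simpa only [joinParam, Fin.insertNth_apply_succAbove] using (η i).2

theorem continuous_joinParam (t : ℝ) : Continuous (joinParam k t) :=
  Continuous.finInsertNth (A := fun _ => ℝ) k continuous_const (by fun_prop)

theorem contDiff_joinParam (η : Fin n → Icc (-1 : ℝ) 1) :
    ContDiff ℝ ∞ fun t => joinParam k t η := by
  refine contDiff_pi.2 ?_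
  rw [Fin.forall_iff_succAbove k]
  refine ⟨?_, fun i => ?_⟩
  · simpa only [joinParam, Fin.insertNth_apply_same] using contDiff_fun_id
  · simpa only [joinParam, Fin.insertNth_apply_succAbove] using contDiff_const

theorem paramDeriv_joinParam (m : ℕ) (f : (Fin (n + 1) → ℝ) → ℝ) (t : ℝ)
    (η : Fin n → Icc (-1 : ℝ) 1) :
    paramDeriv k m f (joinParam k t η) =
      iteratedDerivWithin m (fun s => f (joinParam k s η)) (Icc (-1 : ℝ) 1) t := by
  simp only [paramDeriv, joinParam, Fin.update_insertNth, Fin.insertNth_apply_same]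

end Parameters

/-! ### Continuity of the stiffness entries in the remaining parameters -/

section Stiffness

/-- The energy form of two cell solutions is the inner product of the `L²` classes of their weak
gradients, weighted by the coefficient. -/
theorem energyForm_eq_inner_mulL {d : ℕ} {D : Set (Space d)} {a u v : Space d → ℝ}
    (ha : MemLp a ⊤ (volume.restrict D)) (hu : MemLp (weakGradient D u) 2 (volume.restrict D))
    (hv : MemLp (weakGradient D v) 2 (volume.restrict D)) :
    energyForm D a u v = ⟪mulL ha.toLp hu.toLp, hv.toLp⟫ := by
  rw [inner_mulL, energyForm]
  refine integral_congr_ae ?_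
  filter_upwards [ha.coeFn_toLp, hu.coeFn_toLp, hv.coeFn_toLp] with x h1 h2 h3
  rw [h1, h2, h3]

/-- The stiffness entries depend continuously on the parameters. -/
theorem continuous_stiffness_joinParam {d n L : ℕ} {D : Set (Space d)} (hD : IsOpen D)
    {κ : Space d → (Fin (n + 1) → ℝ) → ℝ}
    (hκ_meas : ∀ ξ ∈ paramCube (n + 1),
      AEStronglyMeasurable (fun x => κ x ξ) (volume.restrict D))
    {κmin κmax : ℝ} (hκmin : 0 < κmin)
    (hκ_bounds : ∀ ξ ∈ paramCube (n + 1), ∀ᵐ x ∂(volume.restrict D),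
      κmin ≤ κ x ξ ∧ κ x ξ ≤ κmax)
    (hκ_smooth : ∀ᵐ x ∂(volume.restrict D), ContDiffOn ℝ ∞ (κ x) (paramCube (n + 1)))
    {p : Fin L → Space d → ℝ} (hp : ∀ l, MemH1 D (p l))
    {φ : Fin L → (Fin (n + 1) → ℝ) → Space d → ℝ}
    (hφ : ∀ l, ∀ ξ ∈ paramCube (n + 1), IsCellSolution D (fun x => κ x ξ) (p l) (φ l ξ))
    (l l' : Fin L) (k : Fin (n + 1)) {t : ℝ} (ht : t ∈ Icc (-1 : ℝ) 1) :
    Continuous fun η => stiffness D κ φ (joinParam k t η) l l' := by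
  have habs : ∀ ξ ∈ paramCube (n + 1), ∀ᵐ x ∂(volume.restrict D), |κ x ξ| ≤ κmax := fun ξ hξ => by
    filter_upwards [hκ_bounds ξ hξ] with x hx
    rw [abs_of_pos (hκmin.trans_le hx.1)]
    exact hx.2
  have hmem : ∀ η, joinParam k t η ∈ paramCube (n + 1) := joinParam_mem_paramCube k ht
  have hκm : ∀ η, MemLp (fun x => κ x (joinParam k t η)) ⊤ (volume.restrict D) := fun η =>
    memLp_top_of_bound (hκ_meas _ (hmem η)) κmax (habs _ (hmem η))
  have hGm : ∀ l η, MemLp (weakGradient D (φ l (joinParam k t η))) 2 (volume.restrict D) :=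
    fun l η => (hφ l _ (hmem η)).1.memLp_weakGradient hD
  have horth : ∀ l η, ∀ v ∈ gradientSpace D, ⟪mulL (hκm η).toLp (hGm l η).toLp, v⟫ = 0 :=
    fun l η v hv => by
      rw [← (hφ l _ (hmem η)).integral_eq_zero hD (hκ_meas _ (hmem η)) (habs _ (hmem η)) v hv,
        inner_mulL]
      refine integral_congr_ae ?_
      filter_upwards [(hκm η).coeFn_toLp] with x hx
      rw [hx]
  have hval : ∀ η, stiffness D κ φ (joinParam k t η) l l' =
      ⟪mulL (hκm η).toLp (hGm l η).toLp, (hGm l' η).toLp⟫ := fun η =>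
    energyForm_eq_inner_mulL (hκm η) (hGm l η) (hGm l' η)
  -- Sequences suffice on the metrizable cube, and they are what dominated convergence and countable
  -- unions of null sets require.
  refine continuous_iff_seqContinuous.2 fun η η₀ hη => ?_
  simp only [Function.comp_def, hval]
  refine tendsto_energy (C := κmax) hκmin (fun j => ?_) ?_ ?_ (gradientSpace D)
    (fun j => (hφ l _ (hmem _)).toLp_sub_mem hD (hp l))
    (fun j => (hφ l' _ (hmem _)).toLp_sub_mem hD (hp l'))
    ((hφ l _ (hmem _)).toLp_sub_mem hD (hp l)) ((hφ l' _ (hmem _)).toLp_sub_mem hD (hp l'))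
    (fun j => horth l _) (horth l' _)
  · filter_upwards [(hκm (η j)).coeFn_toLp, hκ_bounds _ (hmem (η j))] with x h1 h2
    rwa [h1]
  · filter_upwards [(hκm η₀).coeFn_toLp, habs _ (hmem η₀)] with x h1 h2
    rwa [h1]
  · filter_upwards [(hκm η₀).coeFn_toLp, ae_all_iff.2 fun j => (hκm (η j)).coeFn_toLp, hκ_smooth]
      with x h1 h2 h3
    simp only [h1, h2]
    exact (h3.continuousOn _ (hmem η₀)).tendsto.comp (tendsto_nhdsWithin_iff.2
      ⟨((continuous_joinParam k t).tendsto η₀).comp hη, Eventually.of_forall fun j => hmem _⟩)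

end Stiffness

end StoMsFEM

/-- There are `n + 1` local parameters; `k` is the one in which the stiffness entry is extended
to complex values. -/
theorem theorem3p1 {d n L : ℕ}
    (D : Set (StoMsFEM.Space d)) (hD_open : IsOpen D) (hD_bdd : Bornology.IsBounded D)
    -- the coefficient: measurable in `x`, bounded and uniformly elliptic
    (κ : StoMsFEM.Space d → (Fin (n + 1) → ℝ) → ℝ)
    (hκ_meas : ∀ ξ ∈ StoMsFEM.paramCube (n + 1),
      AEStronglyMeasurable (fun x => κ x ξ) (volume.restrict D))
    (κmin κmax : ℝ) (hκmin : 0 < κmin)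
    (hκ_bounds : ∀ ξ ∈ StoMsFEM.paramCube (n + 1), ∀ᵐ x ∂(volume.restrict D),
      κmin ≤ κ x ξ ∧ κ x ξ ≤ κmax)
    -- infinitely differentiable in the parameters
    (hκ_smooth : ∀ᵐ x ∂(volume.restrict D),
      ContDiffOn ℝ ∞ (κ x) (StoMsFEM.paramCube (n + 1)))
    -- growth of the derivatives in the `k`-th parameter
    (k : Fin (n + 1)) (c : ℝ) (hc : 0 < c)
    (hκ_growth : ∀ ξ ∈ StoMsFEM.paramCube (n + 1), ∀ m : ℕ,
      eLpNorm (fun x => StoMsFEM.paramDeriv k m (κ x) ξ / κ x ξ) ⊤ (volume.restrict D)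
        ≤ ENNReal.ofReal (c ^ m * (m.factorial : ℝ)))
    -- deterministic boundary data and multiscale basis functions
    (p : Fin L → StoMsFEM.Space d → ℝ) (hp : ∀ l, StoMsFEM.MemH1 D (p l))
    (φ : Fin L → (Fin (n + 1) → ℝ) → StoMsFEM.Space d → ℝ)
    (hφ : ∀ l, ∀ ξ ∈ StoMsFEM.paramCube (n + 1),
      StoMsFEM.IsCellSolution D (fun x => κ x ξ) (p l) (φ l ξ))
    (l l' : Fin L) (τ : ℝ) (hτ : 0 < τ) (hτc : τ < 1 / (2 * c)) :
    ∃ F : ℂ → C(Fin n → Icc (-1 : ℝ) 1, ℂ),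
      AnalyticOnNhd ℂ F (StoMsFEM.sigmaRegion τ) ∧
      ∀ t ∈ Icc (-1 : ℝ) 1, ∀ η : Fin n → Icc (-1 : ℝ) 1,
        F (t : ℂ) η = ((StoMsFEM.stiffness D κ φ (StoMsFEM.joinParam k t η) l l' : ℝ) : ℂ) := by
  open StoMsFEM in
  classical
  have habs : ∀ ξ ∈ paramCube (n + 1), ∀ᵐ x ∂(volume.restrict D), |κ x ξ| ≤ κmax := fun ξ hξ => by
    filter_upwards [hκ_bounds ξ hξ] with x hx
    rw [abs_of_pos (hκmin.trans_le hx.1)]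
    exact hx.2
  refine exists_analytic_extension_of_powerSeries (ρ := 2 * c)
    -- The constant C chosen next involves only κmax and the boundary data, so it serves every
    -- centre t₀ and every η.
    (f := fun t η => stiffness D κ φ (joinParam k t η) l l')
    (C := 2 * (√κmax * ‖((hp l).memLp_weakGradient hD_open).toLp‖) *
      (√κmax * ‖((hp l').memLp_weakGradient hD_open).toLp‖)) (by positivity) hτ hτc
    (fun t ht => continuous_stiffness_joinParam hD_open hκ_meas hκmin hκ_bounds hκ_smooth hp hφ
      l l' k ht) fun t₀ ht₀ η => ?_
  have hmem : ∀ t ∈ Icc (-1 : ℝ) 1, joinParam k t η ∈ paramCube (n + 1) := fun t ht =>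
    joinParam_mem_paramCube k ht η
  have hGm : ∀ l, ∀ t ∈ Icc (-1 : ℝ) 1,
      MemLp (weakGradient D (φ l (joinParam k t η))) 2 (volume.restrict D) :=
    fun l t ht => (hφ l _ (hmem t ht)).1.memLp_weakGradient hD_open
  let G : Fin L → ℝ → Lp (Space d) 2 (volume.restrict D) := fun l t =>
    if h : t ∈ Icc (-1 : ℝ) 1 then (hGm l t h).toLp else 0
  have hG : ∀ l, ∀ t (ht : t ∈ Icc (-1 : ℝ) 1), G l t = (hGm l t ht).toLp := fun l t ht =>
    dif_pos ht
  obtain ⟨s, hs, hsum⟩ := exists_hasSum_energy_of_growth (μ := volume.restrict D)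
    (a := fun x t => κ x (joinParam k t η)) (fun t ht => hκ_meas _ (hmem t ht))
    (by
      filter_upwards [hκ_smooth] with x hx
      exact hx.comp (contDiff_joinParam k η).contDiffOn hmem)
    hκmin (fun t ht => hκ_bounds _ (hmem t ht)) hc.le
    (fun t ht m => by simpa only [paramDeriv_joinParam] using hκ_growth _ (hmem t ht) m)
    (gradientSpace D) (isClosed_gradientSpace D) ((hp l).memLp_weakGradient hD_open).toLp
    ((hp l').memLp_weakGradient hD_open).toLp (G l) (G l')
    (fun t ht => by rw [hG l t ht]; exact (hφ l _ (hmem t ht)).toLp_sub_mem hD_open (hp l))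
    (fun t ht => by rw [hG l' t ht]; exact (hφ l' _ (hmem t ht)).toLp_sub_mem hD_open (hp l'))
    (fun t ht v hv => by
      rw [hG l t ht]
      exact (hφ l _ (hmem t ht)).integral_eq_zero hD_open (hκ_meas _ (hmem t ht))
        (habs _ (hmem t ht)) v hv)
    ht₀
  refine ⟨s, hs, fun t ht htt => ?_⟩
  convert hsum t ht htt using 1
  change energyForm D _ _ _ = _
  rw [energyForm, hG l t ht, hG l' t ht]
  refine integral_congr_ae ?_
  filter_upwards [(hGm l t ht).coeFn_toLp, (hGm l' t ht).coeFn_toLp] with x h1 h2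
  rw [h1, h2]
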